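/- Let $m\ge 2$ and let $M\subset\mathbb C^m$ be a domain (nonempty, open, connected). Suppose $M$ carries a smooth Hermitian metric $\gamma$ which is conformal to the Euclidean one, $\gamma_{\alpha\bar\beta}=f\,\delta_{\alpha\beta}$ with $f:M\to(0,\infty)$, such that: (i) $\gamma$ is rotationally symmetric, i.e. $M$ and the Riemannian metric $g=\operatorname{Re}\sum\gamma_{\alpha\bar\beta}\,dz^\alpha\otimes d\bar z^\beta$ are invariant under all rotations $A\in SO(2m)$ of $\mathbb C^m=\mathbb R^{2m}$ about the origin; (ii) $M$ is complete for the Riemannian distance $d$ of $g$; (iii) $g$ has nonpositive sectional curvature. For a smooth map $u$ from $M$ to a Riemannian manifold $(N,g)$ with Christoffel symbols $\Gamma^\ell_{jk}$, let $$\sigma(u)^\ell=\sum_{\alpha,\beta}\gamma^{\alpha\bar\beta}\Big(\frac{\partial^2u^\ell}{\partial z^\alpha\,\partial\bar z^\beta}+\sum_{j,k}\Gamma^\ell_{jk}(u)\,\frac{\partial u^j}{\partial z^\alpha}\frac{\partial u^k}{\partial\bar z^\beta}\Big)$$ be its Hermitian tension field, where $(\gamma^{\alpha\bar\beta})$ is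 the transposed inverse of $(\gamma_{\alpha\bar\beta})$, and let $\sigma(\mathrm{id})$ be the tension field of the identity map $(M,\gamma)\to(M,g)$, with norm $\|\sigma(\mathrm{id})\|$ measured in $g$. Suppose that $\|\sigma(\mathrm{id})\|\in C^0_\lambda(M)$ for some $\lambda>1$, i.e. $\|\sigma(\mathrm{id})\|$ is continuous on $M$ and there are $z_0\in M$ and a constant $C$ with $\|\sigma(\mathrm{id})\|(z)\le C\,(1+d(z,z_0))^{-\lambda}$ for all $z\in M$. Then $M=\mathbb C^m$, the metric is a constant positive multiple of the Euclidean one, i.e. there is a constant $c>0$ with $\gamma_{\alpha\bar\beta}(z)=c\,\delta_{\alpha\beta}$ for all $z\in\mathbb C^m$, and $\sigma(\mathrm{id})\equiv 0$. -/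

import Mathlib

open scoped ContDiff Matrix ComplexOrder

namespace HermitianGeometry

noncomputable section

/-! ### Riemannian geometry in linear coordinates

`V` is a finite-dimensional real vector space with linear coordinates given by a basis `b`; a
Riemannian metric on an open subset of `V` is given by its matrix `g x i j = g_{ij}(x)`. -/

section Riemannian

variable {ι V : Type*} [Fintype ι] [DecidableEq ι] [NormedAddCommGroup V] [NormedSpace ℝ V]

/-- The partial derivative `∂φ/∂x^i` of a real function in the coordinates of `b`. -/
def partialDeriv (b : Module.Basis ι ℝ V) (i : ι) (φ : V → ℝ) (x : V) : ℝ :=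
  fderiv ℝ φ x (b i)

/-- The Christoffel symbols `Γ^j_{kl}` of the Levi-Civita connection of `g`. -/
def christoffel (b : Module.Basis ι ℝ V) (g : V → Matrix ι ι ℝ) (j k l : ι) (x : V) : ℝ :=
  (1 / 2) * ∑ s, (g x)⁻¹ j s *
    (partialDeriv b k (fun y => g y l s) x + partialDeriv b l (fun y => g y s k) x
      - partialDeriv b s (fun y => g y k l) x)

/-- The component `R^l_{kij}` of the curvature tensor, that is
`R(∂_i, ∂_j) ∂_k = ∑_l R^l_{kij} ∂_l` where
`R(X, Y) Z = ∇_X ∇_Y Z - ∇_Y ∇_X Z - ∇_{[X, Y]} Z`. -/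
def curvature (b : Module.Basis ι ℝ V) (g : V → Matrix ι ι ℝ) (l k i j : ι) (x : V) : ℝ :=
  partialDeriv b i (christoffel b g l j k) x - partialDeriv b j (christoffel b g l i k) x
    + ∑ s, (christoffel b g l i s x * christoffel b g s j k x
        - christoffel b g l j s x * christoffel b g s i k x)

/-- The scalar product `g_x(v, w)` of vectors given by their components. -/
def metricForm (g : V → Matrix ι ι ℝ) (x : V) (v w : ι → ℝ) : ℝ :=
  ∑ i, ∑ j, g x i j * v i * w j

/-- The sectional curvature at `x` of the plane spanned by the linearly independent vectors with
components `v` and `w`: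
`g(R(v, w) w, v) / (g(v, v) g(w, w) - g(v, w)²)`. -/
def sectionalCurvature (b : Module.Basis ι ℝ V) (g : V → Matrix ι ι ℝ) (x : V)
    (v w : ι → ℝ) : ℝ :=
  (∑ i, ∑ j, ∑ k, ∑ l, ∑ p, g x l p * curvature b g l k i j x * v i * w j * w k * v p) /
    (metricForm g x v v * metricForm g x w w - metricForm g x v w ^ 2)

/-- `g` has nonpositive sectional curvature on `N`. -/
def HasNonposSectionalCurvature (b : Module.Basis ι ℝ V) (N : Set V)
    (g : V → Matrix ι ι ℝ) : Prop :=
  ∀ x ∈ N, ∀ v w : ι → ℝ, LinearIndependent ℝ ![v, w] → sectionalCurvature b g x v w ≤ 0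

end Riemannian

/-! ### Hermitian metrics on open subsets of `ℂ^m` -/

/-- The space `ℂ^m` with its Euclidean norm. -/
abbrev Cm (m : ℕ) : Type := EuclideanSpace ℂ (Fin m)

/-- The real coordinates `(x^α, y^α)` of `ℂ^m`: the basis vectors are `e_α` (index `(0, α)`) and
`i e_α` (index `(1, α)`). -/
def realBasis (m : ℕ) : Module.Basis (Fin 2 × Fin m) ℝ (Cm m) :=
  Complex.basisOneI.smulTower (EuclideanSpace.basisFun (Fin m) ℂ).toBasis

variable {m : ℕ}

/-- `γ z α β = γ_{αβ̄}(z)` is a smooth Hermitian metric on the open set `M`. -/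
structure IsHermitianMetric (M : Set (Cm m)) (γ : Cm m → Matrix (Fin m) (Fin m) ℂ) : Prop where
  smooth : ∀ α β, ContDiffOn ℝ ∞ (fun z => γ z α β) M
  posDef : ∀ z ∈ M, (γ z).PosDef

/-- The real scalar product `Re ∑ γ_{αβ̄} v^α w̄^β` of two tangent vectors at `z`. -/
def realForm (γ : Cm m → Matrix (Fin m) (Fin m) ℂ) (z v w : Cm m) : ℝ :=
  (∑ α, ∑ β, v α * γ z α β * (starRingEnd ℂ) (w β)).re

/-- The underlying Riemannian metric of a Hermitian metric, in the real coordinates of `ℂ^m`. -/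
def riemannian (γ : Cm m → Matrix (Fin m) (Fin m) ℂ) (z : Cm m) :
    Matrix (Fin 2 × Fin m) (Fin 2 × Fin m) ℝ :=
  Matrix.of fun j k => realForm γ z (realBasis m j) (realBasis m k)

/-- The metric is conformal to the Euclidean one on `M`. -/
def IsConformalToEuclidean (M : Set (Cm m)) (γ : Cm m → Matrix (Fin m) (Fin m) ℂ) : Prop :=
  ∃ f : Cm m → ℝ, ∀ z ∈ M, 0 < f z ∧ γ z = (f z : ℂ) • (1 : Matrix (Fin m) (Fin m) ℂ)

/-- The domain `M` and the metric on it are invariant under all rotations `A ∈ SO(2m)` of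
`ℂ^m = ℝ^{2m}` about the origin. -/
def IsRotationallySymmetric (M : Set (Cm m)) (γ : Cm m → Matrix (Fin m) (Fin m) ℂ) : Prop :=
  ∀ A : Cm m ≃ₗᵢ[ℝ] Cm m, LinearMap.det (A.toLinearEquiv : Cm m →ₗ[ℝ] Cm m) = 1 →
    ∀ z ∈ M, A z ∈ M ∧ ∀ v w, realForm γ (A z) (A v) (A w) = realForm γ z v w

/-- The `C^1` curves `c : [0, 1] → M` from `x` to `y`. -/
def curvesIn (M : Set (Cm m)) (x y : Cm m) : Set (ℝ → Cm m) :=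
  {c | ContDiffOn ℝ 1 c (Set.Icc 0 1) ∧ Set.MapsTo c (Set.Icc 0 1) M ∧ c 0 = x ∧ c 1 = y}

/-- The length of a curve `c : [0, 1] → M`. -/
def curveLength (γ : Cm m → Matrix (Fin m) (Fin m) ℂ) (c : ℝ → Cm m) : ENNReal :=
  ∫⁻ t in Set.Icc (0 : ℝ) 1, ENNReal.ofReal
    (√(realForm γ (c t) (derivWithin c (Set.Icc 0 1) t) (derivWithin c (Set.Icc 0 1) t)))

/-- The Riemannian distance on `M`: the infimum of the lengths of the curves in `M` from `x`
to `y`. It is finite on a connected open `M`. -/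
def riemEDist (M : Set (Cm m)) (γ : Cm m → Matrix (Fin m) (Fin m) ℂ) (x y : Cm m) : ENNReal :=
  ⨅ c ∈ curvesIn M x y, curveLength γ c

/-- The metric on `M` is complete: Cauchy sequences for the Riemannian distance converge in `M`. -/
def IsCompleteMetric (M : Set (Cm m)) (γ : Cm m → Matrix (Fin m) (Fin m) ℂ) : Prop :=
  ∀ x : ℕ → Cm m, (∀ n, x n ∈ M) →
    (∀ ε > 0, ∃ N, ∀ n ≥ N, ∀ k ≥ N, riemEDist M γ (x n) (x k) < ε) →
    ∃ y ∈ M, Filter.Tendsto (fun n => riemEDist M γ (x n) y) Filter.atTop (nhds 0)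

/-- The space `C^0_μ(M)` of the continuous functions `φ : M → ℝ` with
`|φ(z)| ≤ C (1 + d(z, z₀))^{-μ}` for some `z₀ ∈ M` and some constant `C`. -/
def DecayC0 (M : Set (Cm m)) (γ : Cm m → Matrix (Fin m) (Fin m) ℂ) (μ : ℝ) : Set (Cm m → ℝ) :=
  {φ | ContinuousOn φ M ∧ ∃ z₀ ∈ M, ∃ C : ℝ, ∀ z ∈ M,
    |φ z| ≤ C * (1 + (riemEDist M γ z z₀).toReal) ^ (-μ)}

/-! ### The Hermitian tension field -/

/-- The Wirtinger derivative `∂φ/∂z^α`. -/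
def dz (α : Fin m) (φ : Cm m → ℂ) (z : Cm m) : ℂ :=
  (1 / 2) * (fderiv ℝ φ z (EuclideanSpace.single α 1)
    - Complex.I * fderiv ℝ φ z (EuclideanSpace.single α Complex.I))

/-- The Wirtinger derivative `∂φ/∂z̄^α`. -/
def dzbar (α : Fin m) (φ : Cm m → ℂ) (z : Cm m) : ℂ :=
  (1 / 2) * (fderiv ℝ φ z (EuclideanSpace.single α 1)
    + Complex.I * fderiv ℝ φ z (EuclideanSpace.single α Complex.I))

section Tension

variable {ι V : Type*} [Fintype ι] [DecidableEq ι] [NormedAddCommGroup V] [NormedSpace ℝ V]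

/-- The Hermitian tension field of a map `u` from (an open subset of) `ℂ^m` with the Hermitian
metric `γ` to (an open subset of) `V` with the Riemannian metric `g`:
`σ(u)^l = γ^{αβ̄} (∂²u^l/∂z^α∂z̄^β + Γ^l_{jk} ∂u^j/∂z^α ∂u^k/∂z̄^β)`,
where `γ^{αβ̄}` is the transposed inverse of `γ_{αβ̄}`. (The components are in fact real.) -/
def tension (b : Module.Basis ι ℝ V) (γ : Cm m → Matrix (Fin m) (Fin m) ℂ)
    (g : V → Matrix ι ι ℝ) (u : Cm m → V) (z : Cm m) (l : ι) : ℂ :=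
  ∑ α, ∑ β, ((γ z)ᵀ)⁻¹ α β *
    (dz α (dzbar β (fun w => ((b.repr (u w) l : ℝ) : ℂ))) z
      + ∑ j, ∑ k, (christoffel b g l j k (u z) : ℂ)
          * dz α (fun w => ((b.repr (u w) j : ℝ) : ℂ)) z
          * dzbar β (fun w => ((b.repr (u w) k : ℝ) : ℂ)) z)

/-- The norm `‖σ(u)‖` of the tension field, measured with the metric `g` of the target. -/
def tensionNorm (b : Module.Basis ι ℝ V) (γ : Cm m → Matrix (Fin m) (Fin m) ℂ)
    (g : V → Matrix ι ι ℝ) (u : Cm m → V) (z : Cm m) : ℝ :=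
  √(∑ j, ∑ k, (g (u z) j k : ℂ) * tension b γ g u z j
      * (starRingEnd ℂ) (tension b γ g u z k)).re

end Tension

/-- The tension field of the identity map from `(M, γ)` to `M` with the Riemannian metric
underlying `γ`. -/
def tensionId (γ : Cm m → Matrix (Fin m) (Fin m) ℂ) (z : Cm m) : Fin 2 × Fin m → ℂ :=
  tension (realBasis m) γ (riemannian γ) id z

/-- The norm of the tension field of the identity map. -/
def tensionIdNorm (γ : Cm m → Matrix (Fin m) (Fin m) ℂ) (z : Cm m) : ℝ :=
  tensionNorm (realBasis m) γ (riemannian γ) id z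

end

end HermitianGeometry

open HermitianGeometry

/-!
Write the metric as `γ = F(r) δ` with `r = |z|`; this is possible since `SO(2m)` acts transitively
on spheres (`exists_isRadialMetric`). Let `p(r) = r F'(r) / (2 F(r))` be the logarithmic derivative
of `√F` (`logSlope`), and let `s` be the arc length along rays, so that `ds = √F dr` (`arcLength`).
By explicit formulas for conformally flat metrics:

* the radial planes have nonpositive curvature if and only if `p` is nondecreasing
  (`monotoneOn_logSlope`),
* the planes tangent to the spheres have nonpositive curvature if and only if `p (p + 2) ≥ 0`
  (`logSlope_nonneg_or_le`),
* `‖σ(id)‖` is `(m - 1) / 2` times the absolute value of the derivative of `log F / 2` with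
  respect to `s` (`tensionIdNorm_eq`).

The Riemannian distance is at least the difference of arc lengths, with equality along rays, so
completeness implies that the range of `s` is closed: rays have infinite length, and so have the
radial segments towards the inner end of `M` if `M` omits the origin.

If `M` omitted the origin, then by connectedness `p ≥ 0` everywhere or `p ≤ -2` everywhere. In the
first case `F` is bounded near the inner end; in the second `√F = O(r⁻²)` at the outer end. Either
way one of the two lengths is finite, a contradiction (`zero_mem`).

So `M` contains the origin, `p(0) = 0`, and `p ≥ 0` by monotonicity. The decay of `‖σ(id)‖` bounds
the derivative of `log F / 2` with respect to `s` by a multiple of `(1 + s)^{-λ}`, which is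
integrable as `λ > 1`; hence `F` is bounded (`exists_bound`). Since rays have infinite length, `M`
is all of `ℂ^m`. A positive value `ε` of `p` would make `F` grow at least like `r^{2ε}`, because
`p` is nondecreasing (`logSlope_nonpos_of_bound`). So `p = 0`, and `F` is constant.
-/

namespace HermitianGeometry

/-! ### Curvature of conformally flat metrics -/

section ConformallyFlat

variable {ι V : Type*} [NormedAddCommGroup V] [NormedSpace ℝ V]

/-- The components `∂_i (log f) / 2` of the differential of the conformal exponent of the metric
`f δ_{ij}`. -/
noncomputable def logGrad (b : Module.Basis ι ℝ V) (f : V → ℝ) (i : ι) (x : V) : ℝ :=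
  partialDeriv b i f x / (2 * f x)

lemma partialDeriv_congr (b : Module.Basis ι ℝ V) (i : ι) {φ ψ : V → ℝ} {x : V}
    (h : φ =ᶠ[nhds x] ψ) : partialDeriv b i φ x = partialDeriv b i ψ x := by
  simp only [partialDeriv, h.fderiv_eq]

lemma partialDeriv_neg (b : Module.Basis ι ℝ V) (i : ι) (φ : V → ℝ) (x : V) :
    partialDeriv b i (fun y => -φ y) x = -partialDeriv b i φ x := by
  simp only [partialDeriv, fderiv_fun_neg, neg_apply]

variable [DecidableEq ι] {b : Module.Basis ι ℝ V} {g : V → Matrix ι ι ℝ} {f : V → ℝ} {U : Set V}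

lemma partialDeriv_conformal (hU : IsOpen U)
    (hg : ∀ y ∈ U, g y = f y • (1 : Matrix ι ι ℝ)) {x : V} (hx : x ∈ U) (i k l : ι) :
    partialDeriv b i (fun y => g y k l) x = if k = l then partialDeriv b i f x else 0 := by
  have h : (fun y => g y k l) =ᶠ[nhds x] fun y => if k = l then f y else 0 := by
    filter_upwards [hU.mem_nhds hx] with y hy
    simp [hg y hy, Matrix.one_apply]
  rw [partialDeriv_congr b i h]
  split_ifs
  · rfl
  · simp [partialDeriv]

lemma linearIndependent_single_pair {p q : ι} (hpq : p ≠ q) :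
    LinearIndependent ℝ ![(Pi.single p 1 : ι → ℝ), Pi.single q 1] := by
  rw [LinearIndependent.pair_iff]
  intro s t h
  have h1 := congrFun h p
  have h2 := congrFun h q
  simp [hpq, hpq.symm] at h1 h2
  exact ⟨h1, h2⟩

variable [Fintype ι]

lemma christoffel_conformal (hU : IsOpen U)
    (hg : ∀ y ∈ U, g y = f y • (1 : Matrix ι ι ℝ)) (hf : ∀ y ∈ U, f y ≠ 0)
    {x : V} (hx : x ∈ U) (j k l : ι) :
    christoffel b g j k l x = (if l = j then logGrad b f k x else 0)
      + (if j = k then logGrad b f l x else 0) - (if k = l then logGrad b f j x else 0) := by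
  have hinv : (g x)⁻¹ = (f x)⁻¹ • (1 : Matrix ι ι ℝ) := by
    rw [hg x hx]
    apply Matrix.inv_eq_right_inv
    rw [Matrix.smul_mul, Matrix.mul_smul, smul_smul, mul_inv_cancel₀ (hf x hx)]
    simp
  have hfx := hf x hx
  simp only [christoffel, partialDeriv_conformal hU hg hx, hinv, Matrix.smul_apply,
    Matrix.one_apply, smul_eq_mul, mul_ite, mul_one, mul_zero, ite_mul, zero_mul,
    Finset.sum_ite_eq, Finset.mem_univ, if_true, logGrad]
  split_ifs <;> field_simp <;> ring

lemma curvature_conformal (hU : IsOpen U)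
    (hg : ∀ y ∈ U, g y = f y • (1 : Matrix ι ι ℝ)) (hf : ∀ y ∈ U, f y ≠ 0)
    {x : V} (hx : x ∈ U) {p q : ι} (hpq : p ≠ q) :
    curvature b g p q p q x = -partialDeriv b p (logGrad b f p) x
      - partialDeriv b q (logGrad b f q) x + logGrad b f p x ^ 2 + logGrad b f q x ^ 2
      - ∑ s, logGrad b f s x ^ 2 := by
  have h1 : christoffel b g p q q =ᶠ[nhds x] fun y => -logGrad b f p y := by
    filter_upwards [hU.mem_nhds hx] with y hy
    rw [christoffel_conformal hU hg hf hy]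
    simp [hpq, hpq.symm]
  have h2 : christoffel b g p p q =ᶠ[nhds x] logGrad b f q := by
    filter_upwards [hU.mem_nhds hx] with y hy
    rw [christoffel_conformal hU hg hf hy]
    simp [hpq, hpq.symm]
  have h3 : ∀ s, christoffel b g p p s x * christoffel b g s q q x
      - christoffel b g p q s x * christoffel b g s p q x
      = (if s = p then -logGrad b f q x ^ 2 else 0)
        + (if s = q then 2 * logGrad b f q x ^ 2 + logGrad b f p x ^ 2 else 0)
        - logGrad b f s x ^ 2 := by
    intro s
    simp only [christoffel_conformal hU hg hf hx]
    by_cases hsp : s = p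
    · subst hsp
      simp [hpq, hpq.symm]
      ring
    · by_cases hsq : s = q
      · subst hsq
        simp [hpq, hpq.symm]
        ring
      · simp [hpq, hsp, hsq, Ne.symm hsp, Ne.symm hsq]
        ring
  rw [curvature, partialDeriv_congr b p h1, partialDeriv_congr b q h2, partialDeriv_neg,
    Finset.sum_congr rfl fun s _ => h3 s]
  simp only [Finset.sum_sub_distrib, Finset.sum_add_distrib, Finset.sum_ite_eq',
    Finset.mem_univ, if_true]
  ring

lemma sectionalCurvature_conformal (hU : IsOpen U)
    (hg : ∀ y ∈ U, g y = f y • (1 : Matrix ι ι ℝ)) (hf : ∀ y ∈ U, f y ≠ 0)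
    {x : V} (hx : x ∈ U) {p q : ι} (hpq : p ≠ q) :
    sectionalCurvature b g x (Pi.single p 1) (Pi.single q 1) =
      -(partialDeriv b p (logGrad b f p) x + partialDeriv b q (logGrad b f q) x
        - logGrad b f p x ^ 2 - logGrad b f q x ^ 2 + ∑ s, logGrad b f s x ^ 2) / f x := by
  have hfx := hf x hx
  have hnum : (∑ i, ∑ j, ∑ k, ∑ l, ∑ r, g x l r * curvature b g l k i j x
      * (Pi.single p 1 : ι → ℝ) i * (Pi.single q 1 : ι → ℝ) j
      * (Pi.single q 1 : ι → ℝ) k * (Pi.single p 1 : ι → ℝ) r)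
      = f x * curvature b g p q p q x := by
    rw [hg x hx]
    simp [Pi.single_apply, Matrix.one_apply]
  have hform : ∀ r s : ι, metricForm g x (Pi.single r 1) (Pi.single s 1)
      = if r = s then f x else 0 := by
    intro r s
    rw [metricForm, hg x hx]
    simp [Pi.single_apply, Matrix.one_apply]
  rw [sectionalCurvature, hnum, hform, hform, hform, curvature_conformal hU hg hf hx hpq]
  simp only [if_true, if_neg hpq]
  field_simp
  ring

/-- Nonpositivity of the curvature of the coordinate planes of a conformally flat metric. -/
lemma HasNonposSectionalCurvature.conformal (hcurv : HasNonposSectionalCurvature b U g)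
    (hU : IsOpen U) (hg : ∀ y ∈ U, g y = f y • (1 : Matrix ι ι ℝ)) (hf : ∀ y ∈ U, 0 < f y)
    {x : V} (hx : x ∈ U) {p q : ι} (hpq : p ≠ q) :
    0 ≤ partialDeriv b p (logGrad b f p) x + partialDeriv b q (logGrad b f q) x
        - logGrad b f p x ^ 2 - logGrad b f q x ^ 2 + ∑ s, logGrad b f s x ^ 2 := by
  have h := hcurv x hx _ _ (linearIndependent_single_pair hpq)
  rw [sectionalCurvature_conformal hU hg (fun y hy => (hf y hy).ne') hx hpq,
    div_le_iff₀ (hf x hx)] at h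
  linarith

end ConformallyFlat

/-! ### Real coordinates of `ℂ^m` -/

section Coordinates

variable {m : ℕ}

@[simp] lemma realBasis_repr_zero (x : Cm m) (α : Fin m) :
    (realBasis m).repr x (0, α) = (x α).re := by
  simp [realBasis, Module.Basis.smulTower_repr]

@[simp] lemma realBasis_repr_one (x : Cm m) (α : Fin m) :
    (realBasis m).repr x (1, α) = (x α).im := by
  simp [realBasis, Module.Basis.smulTower_repr]

lemma realBasis_zero (α : Fin m) : realBasis m (0, α) = EuclideanSpace.single α 1 := by
  simp [realBasis, Module.Basis.smulTower_apply]

lemma realBasis_one (α : Fin m) : realBasis m (1, α) = EuclideanSpace.single α Complex.I := by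
  ext β
  simp [realBasis, Module.Basis.smulTower_apply]

lemma inner_eq_sum_re (x y : Cm m) :
    inner ℝ x y = (∑ α, x α * (starRingEnd ℂ) (y α)).re := by
  rw [PiLp.inner_apply, Complex.re_sum]
  refine Finset.sum_congr rfl fun α _ => ?_
  rw [Complex.inner]
  simp
  ring

lemma inner_realBasis (x : Cm m) (k : Fin 2 × Fin m) :
    inner ℝ x (realBasis m k) = (realBasis m).repr x k := by
  obtain ⟨i, α⟩ := k
  fin_cases i
  · simp [inner_eq_sum_re, realBasis_zero]
  · simp only [Fin.mk_one, inner_eq_sum_re, realBasis_one, realBasis_repr_one]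
    rw [Finset.sum_eq_single α] <;> simp +contextual

lemma inner_realBasis_realBasis (j k : Fin 2 × Fin m) :
    inner ℝ (realBasis m j) (realBasis m k) = if j = k then (1 : ℝ) else 0 := by
  rw [inner_realBasis, Module.Basis.repr_self, Finsupp.single_apply]

lemma sum_repr_sq (x : Cm m) : ∑ k, (realBasis m).repr x k ^ 2 = ‖x‖ ^ 2 := by
  rw [EuclideanSpace.norm_sq_eq, Fintype.sum_prod_type, Fin.sum_univ_two,
    ← Finset.sum_add_distrib]
  refine Finset.sum_congr rfl fun α _ => ?_
  rw [realBasis_repr_zero, realBasis_repr_one, Complex.sq_norm, Complex.normSq_apply]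
  ring

lemma realForm_conformal {γ : Cm m → Matrix (Fin m) (Fin m) ℂ} {z : Cm m} {c : ℝ}
    (h : γ z = (c : ℂ) • (1 : Matrix (Fin m) (Fin m) ℂ)) (v w : Cm m) :
    realForm γ z v w = c * inner ℝ v w := by
  rw [realForm, inner_eq_sum_re, ← Complex.re_ofReal_mul, Finset.mul_sum, h]
  congr 1
  refine Finset.sum_congr rfl fun α _ => ?_
  simp [Matrix.one_apply]
  ring

lemma riemannian_conformal {γ : Cm m → Matrix (Fin m) (Fin m) ℂ} {z : Cm m} {c : ℝ}
    (h : γ z = (c : ℂ) • (1 : Matrix (Fin m) (Fin m) ℂ)) :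
    riemannian γ z = c • (1 : Matrix (Fin 2 × Fin m) (Fin 2 × Fin m) ℝ) := by
  ext j k
  simp [riemannian, realForm_conformal h, inner_realBasis_realBasis, Matrix.one_apply]

/-! ### The tension field of the identity -/

lemma fderiv_ofReal_repr (k : Fin 2 × Fin m) (x v : Cm m) :
    fderiv ℝ (fun y => (((realBasis m).repr y k : ℝ) : ℂ)) x v
      = ((realBasis m).repr v k : ℝ) := by
  have : (fun y => (((realBasis m).repr y k : ℝ) : ℂ))
      = (Complex.ofRealCLM.comp ((realBasis m).coord k).toContinuousLinearMap : Cm m → ℂ) := by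
    ext y; simp
  rw [this, ContinuousLinearMap.fderiv]
  simp

lemma dz_ofReal_repr (α : Fin m) (k : Fin 2 × Fin m) (z : Cm m) :
    dz α (fun w => (((realBasis m).repr w k : ℝ) : ℂ)) z
      = (1 / 2) * ((if k = (0, α) then 1 else 0) - Complex.I * if k = (1, α) then 1 else 0) := by
  rw [dz, fderiv_ofReal_repr, fderiv_ofReal_repr, ← realBasis_zero, ← realBasis_one]
  simp only [Module.Basis.repr_self, Finsupp.single_apply, eq_comm (b := k)]
  split_ifs <;> simp

lemma dzbar_ofReal_repr (α : Fin m) (k : Fin 2 × Fin m) (z : Cm m) :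
    dzbar α (fun w => (((realBasis m).repr w k : ℝ) : ℂ)) z
      = (1 / 2) * ((if k = (0, α) then 1 else 0) + Complex.I * if k = (1, α) then 1 else 0) := by
  rw [dzbar, fderiv_ofReal_repr, fderiv_ofReal_repr, ← realBasis_zero, ← realBasis_one]
  simp only [Module.Basis.repr_self, Finsupp.single_apply, eq_comm (b := k)]
  split_ifs <;> simp

lemma dz_dzbar_ofReal_repr (α β : Fin m) (k : Fin 2 × Fin m) (z : Cm m) :
    dz α (dzbar β (fun w => (((realBasis m).repr w k : ℝ) : ℂ))) z = 0 := by
  have : dzbar β (fun w => (((realBasis m).repr w k : ℝ) : ℂ)) = fun _ =>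
      (1 / 2) * ((if k = (0, β) then 1 else 0) + Complex.I * if k = (1, β) then 1 else 0) :=
    funext (dzbar_ofReal_repr β k)
  rw [this, dz]
  simp

variable {M : Set (Cm m)} {γ : Cm m → Matrix (Fin m) (Fin m) ℂ} {f : Cm m → ℝ}

/-- The second derivatives of the coordinates vanish, so that only the trace `2 (1 - m) ∂_l ψ` of
the Christoffel symbols of `e^{2ψ} δ` contributes. -/
lemma tensionId_conformal (hM : IsOpen M)
    (hγ : ∀ z ∈ M, 0 < f z ∧ γ z = (f z : ℂ) • (1 : Matrix (Fin m) (Fin m) ℂ))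
    {z : Cm m} (hz : z ∈ M) (l : Fin 2 × Fin m) :
    tensionId γ z l = ((-((m - 1 : ℝ) / (2 * f z)) * logGrad (realBasis m) f l z : ℝ) : ℂ) := by
  have hfz : (f z : ℂ) ≠ 0 := by exact_mod_cast (hγ z hz).1.ne'
  have hinv : ((γ z)ᵀ)⁻¹ = (f z : ℂ)⁻¹ • (1 : Matrix (Fin m) (Fin m) ℂ) := by
    rw [(hγ z hz).2, Matrix.transpose_smul, Matrix.transpose_one]
    apply Matrix.inv_eq_right_inv
    rw [Matrix.smul_mul, Matrix.mul_smul, smul_smul, mul_inv_cancel₀ hfz]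
    simp
  have hchr := christoffel_conformal (b := realBasis m) hM
    (fun y hy => riemannian_conformal (hγ y hy).2) (fun y hy => (hγ y hy).1.ne') hz
  -- the trace of the Christoffel symbols against `dz^α ⊗ dz̄^α`; the antisymmetric part cancels
  have htr : ∀ α : Fin m, (∑ j, ∑ k, (christoffel (realBasis m) (riemannian γ) l j k z : ℂ)
          * dz α (fun w => (((realBasis m).repr w j : ℝ) : ℂ)) z
          * dzbar α (fun w => (((realBasis m).repr w k : ℝ) : ℂ)) z)
      = (1 / 4) * ((christoffel (realBasis m) (riemannian γ) l (0, α) (0, α) z : ℂ)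
        + (christoffel (realBasis m) (riemannian γ) l (1, α) (1, α) z : ℂ)) := by
    intro α
    have hsymm : christoffel (realBasis m) (riemannian γ) l (0, α) (1, α) z
        = christoffel (realBasis m) (riemannian γ) l (1, α) (0, α) z := by
      rw [hchr, hchr]
      simp [eq_comm, add_comm]
    simp only [dz_ofReal_repr, dzbar_ofReal_repr]
    simp only [mul_add, mul_sub, sub_mul, Finset.sum_add_distrib,
      Finset.sum_sub_distrib, mul_ite, ite_mul, mul_one, mul_zero, zero_mul, Finset.sum_ite_eq',
      Finset.mem_univ, if_true, hsymm]
    linear_combination (-1 / 4 : ℂ) *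
      (christoffel (realBasis m) (riemannian γ) l (1, α) (1, α) z : ℂ) * Complex.I_mul_I
  have hterm : ∀ α β : Fin m, ((γ z)ᵀ)⁻¹ α β *
      (dz α (dzbar β (fun w => (((realBasis m).repr (id w) l : ℝ) : ℂ))) z
      + ∑ j, ∑ k, (christoffel (realBasis m) (riemannian γ) l j k (id z) : ℂ)
          * dz α (fun w => (((realBasis m).repr (id w) j : ℝ) : ℂ)) z
          * dzbar β (fun w => (((realBasis m).repr (id w) k : ℝ) : ℂ)) z)
      = if α = β then (f z : ℂ)⁻¹ * ((1 / 4) *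
        ((christoffel (realBasis m) (riemannian γ) l (0, α) (0, α) z : ℂ)
        + (christoffel (realBasis m) (riemannian γ) l (1, α) (1, α) z : ℂ))) else 0 := by
    intro α β
    by_cases h : α = β
    · subst h
      simp only [id, htr, dz_dzbar_ofReal_repr, hinv]
      simp
    · simp [hinv, h]
  simp only [tensionId, tension, hterm, Finset.sum_ite_eq, Finset.mem_univ, if_true,
    ← Finset.mul_sum]
  have hsum : ∑ α, (christoffel (realBasis m) (riemannian γ) l (0, α) (0, α) z
      + christoffel (realBasis m) (riemannian γ) l (1, α) (1, α) z)
      = (2 - 2 * m) * logGrad (realBasis m) f l z := by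
    have : ∑ α, (christoffel (realBasis m) (riemannian γ) l (0, α) (0, α) z
        + christoffel (realBasis m) (riemannian γ) l (1, α) (1, α) z)
        = ∑ k, christoffel (realBasis m) (riemannian γ) l k k z := by
      rw [Fintype.sum_prod_type, Fin.sum_univ_two, Finset.sum_add_distrib]
    rw [this]
    simp only [hchr, if_true, Finset.sum_sub_distrib, Finset.sum_add_distrib, Finset.sum_ite_eq,
      Finset.sum_ite_eq', Finset.mem_univ, Finset.sum_const, Finset.card_univ,
      Fintype.card_prod, Fintype.card_fin, nsmul_eq_mul]
    push_cast
    ring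
  have hsumC := congrArg (fun r : ℝ => (r : ℂ)) hsum
  push_cast at hsumC
  rw [hsumC]
  push_cast
  field_simp
  ring

lemma tensionIdNorm_conformal (hm : 1 ≤ m) (hM : IsOpen M)
    (hγ : ∀ z ∈ M, 0 < f z ∧ γ z = (f z : ℂ) • (1 : Matrix (Fin m) (Fin m) ℂ))
    {z : Cm m} (hz : z ∈ M) :
    tensionIdNorm γ z
      = (m - 1 : ℝ) / 2 * √((∑ l, logGrad (realBasis m) f l z ^ 2) / f z) := by
  have hfz := (hγ z hz).1
  have hm' : (0 : ℝ) ≤ (m - 1 : ℝ) / 2 := by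
    have : (1 : ℝ) ≤ m := by exact_mod_cast hm
    linarith
  have ht : ∀ l, tension (realBasis m) γ (riemannian γ) id z l
      = ((-((m - 1 : ℝ) / (2 * f z)) * logGrad (realBasis m) f l z : ℝ) : ℂ) :=
    tensionId_conformal hM hγ hz
  rw [tensionIdNorm, tensionNorm, ← Real.sqrt_sq hm', ← Real.sqrt_mul (sq_nonneg _)]
  congr 1
  simp only [ht, id, riemannian_conformal (hγ z hz).2, Complex.conj_ofReal, ← Complex.ofReal_mul,
    ← Complex.ofReal_sum, Complex.ofReal_re]
  simp only [Matrix.smul_apply, Matrix.one_apply, smul_eq_mul, mul_ite, ite_mul, mul_one,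
    mul_zero, zero_mul, Finset.sum_ite_eq, Finset.mem_univ, if_true]
  rw [Finset.sum_div, Finset.mul_sum]
  refine Finset.sum_congr rfl fun l _ => ?_
  field_simp

end Coordinates

/-! ### Reduction to a radial conformal factor -/

section Radial

variable {m : ℕ}

/-- A Hermitian metric given by a function of the norm: `M` is the set of the points whose norm
lies in the open set `I`, and `γ_{αβ̄}(z) = F(|z|) δ_{αβ}` there. Only the norms, that is
`I ∩ [0, ∞)`, matter; negative numbers are admitted in `I` in order that `F` be smooth on an open
set also when `M` contains the origin. -/
structure IsRadialMetric (M : Set (Cm m)) (γ : Cm m → Matrix (Fin m) (Fin m) ℂ)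
    (I : Set ℝ) (F : ℝ → ℝ) : Prop where
  isOpen : IsOpen I
  ordConnected : (I ∩ Set.Ici 0).OrdConnected
  nonempty : (I ∩ Set.Ici 0).Nonempty
  mem_iff : ∀ z, z ∈ M ↔ ‖z‖ ∈ I
  smooth : ContDiffOn ℝ ∞ F I
  pos : ∀ r ∈ I, 0 < F r
  eq : ∀ z ∈ M, γ z = (F ‖z‖ : ℂ) • (1 : Matrix (Fin m) (Fin m) ℂ)

lemma det_reflection_orthogonal_singleton {v : Cm m} (hv : v ≠ 0) :
    LinearMap.det ((Submodule.span ℝ {v})ᗮ.reflection.toLinearEquiv : Cm m →ₗ[ℝ] Cm m) = -1 := by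
  have h := Submodule.det_reflection (𝕜 := ℝ) (Submodule.span ℝ {v})ᗮ
  rw [Submodule.orthogonal_orthogonal, finrank_span_singleton hv, pow_one] at h
  exact h

/-- The rotation group acts transitively on spheres: the reflection exchanging `x` and `y` is
composed with the reflection along `i y`, which fixes `y`. -/
lemma exists_rotation {x y : Cm m} (hxy : ‖x‖ = ‖y‖) :
    ∃ A : Cm m ≃ₗᵢ[ℝ] Cm m,
      LinearMap.det (A.toLinearEquiv : Cm m →ₗ[ℝ] Cm m) = 1 ∧ A x = y := by
  by_cases h : x = y
  · refine ⟨LinearIsometryEquiv.refl ℝ _, ?_, h⟩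
    exact LinearMap.det_id
  have hy : y ≠ 0 := by
    rintro rfl
    exact h (by simpa using hxy)
  have hIy : Complex.I • y ≠ 0 := smul_ne_zero Complex.I_ne_zero hy
  refine ⟨(Submodule.span ℝ {x - y})ᗮ.reflection.trans
    (Submodule.span ℝ {Complex.I • y})ᗮ.reflection, ?_, ?_⟩
  · have h1 := det_reflection_orthogonal_singleton (sub_ne_zero.mpr h)
    have h2 := det_reflection_orthogonal_singleton hIy
    have h3 := LinearMap.det_comp
      ((Submodule.span ℝ {Complex.I • y})ᗮ.reflection.toLinearEquiv : Cm m →ₗ[ℝ] Cm m)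
      ((Submodule.span ℝ {x - y})ᗮ.reflection.toLinearEquiv : Cm m →ₗ[ℝ] Cm m)
    rw [h1, h2, neg_mul_neg, one_mul] at h3
    exact h3
  · rw [LinearIsometryEquiv.trans_apply, Submodule.reflection_sub hxy]
    apply Submodule.reflection_mem_subspace_eq_self
    rw [Submodule.mem_orthogonal_singleton_iff_inner_right, inner_eq_sum_re, Complex.re_sum]
    refine Finset.sum_eq_zero fun α _ => ?_
    simp
    ring

variable {M : Set (Cm m)} {γ : Cm m → Matrix (Fin m) (Fin m) ℂ}

theorem exists_isRadialMetric (hm : 1 ≤ m) (hMopen : IsOpen M) (hMconn : IsConnected M)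
    (hγ : IsHermitianMetric M γ) (hconf : IsConformalToEuclidean M γ)
    (hrot : IsRotationallySymmetric M γ) : ∃ I F, IsRadialMetric M γ I F := by
  obtain ⟨f, hf⟩ := hconf
  let α : Fin m := ⟨0, hm⟩
  let e : Cm m := EuclideanSpace.single α 1
  have he : ‖e‖ = 1 := by simp [e]
  have hcont : ContDiff ℝ ∞ fun r : ℝ => r • e := contDiff_id.smul contDiff_const
  have hnorm : ∀ r : ℝ, 0 ≤ r → ‖r • e‖ = r := fun r hr => by
    rw [norm_smul, he, mul_one, Real.norm_of_nonneg hr]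
  have hinv : ∀ z ∈ M, ∀ w, ‖z‖ = ‖w‖ → w ∈ M ∧ f w = f z := by
    intro z hz w hzw
    obtain ⟨A, hA, rfl⟩ := exists_rotation hzw
    obtain ⟨hAz, hform⟩ := hrot A hA z hz
    refine ⟨hAz, ?_⟩
    have := hform e e
    rw [realForm_conformal (hf _ hAz).2, realForm_conformal (hf z hz).2,
      LinearIsometryEquiv.inner_map_map, real_inner_self_eq_norm_sq, he] at this
    simpa using this
  have hmem : ∀ z, z ∈ M ↔ ‖z‖ • e ∈ M := fun z =>
    ⟨fun hz => (hinv z hz _ (by rw [hnorm _ (norm_nonneg z)])).1,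
      fun hz => (hinv _ hz z (hnorm _ (norm_nonneg z))).1⟩
  have hentry : ∀ z ∈ M, (γ z α α).re = f z := fun z hz => by
    simp [(hf z hz).2]
  have himage : {r : ℝ | r • e ∈ M} ∩ Set.Ici 0 = norm '' M := by
    ext r
    constructor
    · rintro ⟨hr, hr0⟩
      exact ⟨r • e, hr, hnorm r hr0⟩
    · rintro ⟨z, hz, rfl⟩
      exact ⟨(hmem z).1 hz, norm_nonneg z⟩
  refine ⟨{r | r • e ∈ M}, fun r => (γ (r • e) α α).re, ?_, ?_, ?_, hmem, ?_, ?_, ?_⟩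
  · exact hMopen.preimage hcont.continuous
  · rw [himage]
    exact (hMconn.isPreconnected.image _ continuous_norm.continuousOn).ordConnected
  · rw [himage]
    exact hMconn.nonempty.image _
  · exact Complex.reCLM.contDiff.comp_contDiffOn
      ((hγ.smooth α α).comp hcont.contDiffOn fun r hr => hr)
  · intro r hr
    rw [hentry _ hr]
    exact (hf _ hr).1
  · intro z hz
    have hz' := (hmem z).1 hz
    rw [hentry _ hz', (hinv z hz _ (hnorm _ (norm_nonneg z)).symm).2]
    exact (hf z hz).2

/-! ### Curvature and tension of a radial metric -/

namespace IsRadialMetric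

variable {I : Set ℝ} {F : ℝ → ℝ}

lemma conformal (h : IsRadialMetric M γ I F) (z : Cm m) (hz : z ∈ M) :
    0 < F ‖z‖ ∧ γ z = (F ‖z‖ : ℂ) • (1 : Matrix (Fin m) (Fin m) ℂ) :=
  ⟨h.pos _ ((h.mem_iff z).1 hz), h.eq z hz⟩

lemma isOpen_domain (h : IsRadialMetric M γ I F) : IsOpen M := by
  have : M = norm ⁻¹' I := Set.ext h.mem_iff
  rw [this]
  exact h.isOpen.preimage continuous_norm

lemma interior_radii (h : IsRadialMetric M γ I F) :
    interior (I ∩ Set.Ici 0) = I ∩ Set.Ioi 0 := by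
  rw [interior_inter, h.isOpen.interior_eq, interior_Ici]

lemma contDiffAt (h : IsRadialMetric M γ I F) {r : ℝ} (hr : r ∈ I) : ContDiffAt ℝ ∞ F r :=
  h.smooth.contDiffAt (h.isOpen.mem_nhds hr)

lemma hasDerivAt (h : IsRadialMetric M γ I F) {r : ℝ} (hr : r ∈ I) :
    HasDerivAt F (deriv F r) r :=
  ((h.contDiffAt hr).differentiableAt (by simp)).hasDerivAt

lemma differentiableAt_deriv (h : IsRadialMetric M γ I F) {r : ℝ} (hr : r ∈ I) :
    DifferentiableAt ℝ (deriv F) r :=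
  ((h.smooth.deriv_of_isOpen (m := ∞) h.isOpen (by simp)).contDiffAt
    (h.isOpen.mem_nhds hr)).differentiableAt (by simp)

end IsRadialMetric

/-- The logarithmic derivative `r F'(r) / (2 F(r))` of the square root of `F` with respect to
`log r`. Its sum with `1` is the derivative, with respect to arc length, of the radius `r √F(r)`
of the spheres about the origin. -/
noncomputable def logSlope (F : ℝ → ℝ) (r : ℝ) : ℝ := r * deriv F r / (2 * F r)

lemma hasFDerivAt_norm_of_ne {x : Cm m} (hx : x ≠ 0) :
    HasFDerivAt (fun y : Cm m => ‖y‖) (‖x‖⁻¹ • innerSL ℝ x) x := by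
  have h0 : ‖x‖ ≠ 0 := norm_ne_zero_iff.mpr hx
  have h1 := (hasStrictFDerivAt_norm_sq x).hasFDerivAt.sqrt (pow_ne_zero 2 h0)
  simp only [Real.sqrt_sq (norm_nonneg _)] at h1
  have h2 : (1 / (2 * ‖x‖)) • 2 • innerSL ℝ x = ‖x‖⁻¹ • innerSL ℝ x := by
    rw [← Nat.cast_smul_eq_nsmul ℝ, smul_smul]
    congr 1
    push_cast
    field_simp
  rwa [h2] at h1

lemma hasFDerivAt_repr (k : Fin 2 × Fin m) (x : Cm m) :
    HasFDerivAt (fun y => (realBasis m).repr y k)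
      ((realBasis m).coord k).toContinuousLinearMap x :=
  (((realBasis m).coord k).toContinuousLinearMap).hasFDerivAt

lemma partialDeriv_radial {G : ℝ → ℝ} {G' : ℝ} {x : Cm m} (hx : x ≠ 0)
    (hG : HasDerivAt G G' ‖x‖) (k : Fin 2 × Fin m) :
    partialDeriv (realBasis m) k (fun y => G ‖y‖) x = G' / ‖x‖ * (realBasis m).repr x k := by
  have : HasFDerivAt (fun y => G ‖y‖) (G' • ‖x‖⁻¹ • innerSL ℝ x) x :=
    hG.comp_hasFDerivAt x (hasFDerivAt_norm_of_ne hx)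
  rw [partialDeriv, this.fderiv]
  simp only [smul_apply, innerSL_apply_apply, inner_realBasis, smul_eq_mul]
  ring

lemma partialDeriv_radial_mul_repr {G : ℝ → ℝ} {G' : ℝ} {x : Cm m} (hx : x ≠ 0)
    (hG : HasDerivAt G G' ‖x‖) (k : Fin 2 × Fin m) :
    partialDeriv (realBasis m) k (fun y => G ‖y‖ * (realBasis m).repr y k) x
      = G ‖x‖ + G' / ‖x‖ * (realBasis m).repr x k ^ 2 := by
  have : HasFDerivAt (fun y => G ‖y‖ * (realBasis m).repr y k)
      (G ‖x‖ • ((realBasis m).coord k).toContinuousLinearMap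
        + (realBasis m).repr x k • G' • ‖x‖⁻¹ • innerSL ℝ x) x :=
    (hG.comp_hasFDerivAt x (hasFDerivAt_norm_of_ne hx)).mul (hasFDerivAt_repr k x)
  rw [partialDeriv, this.fderiv]
  simp only [add_apply, smul_apply, innerSL_apply_apply, inner_realBasis, smul_eq_mul,
    LinearMap.coe_toContinuousLinearMap', Module.Basis.coord_apply, Module.Basis.repr_self,
    Finsupp.single_eq_same]
  ring

namespace IsRadialMetric

variable {I : Set ℝ} {F : ℝ → ℝ}

lemma logGrad_eq (h : IsRadialMetric M γ I F) {z : Cm m} (hz : z ∈ M) (hz0 : z ≠ 0)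
    (k : Fin 2 × Fin m) :
    logGrad (realBasis m) (fun y => F ‖y‖) k z
      = logSlope F ‖z‖ / ‖z‖ ^ 2 * (realBasis m).repr z k := by
  have hn : ‖z‖ ≠ 0 := norm_ne_zero_iff.mpr hz0
  have hF := (h.pos _ ((h.mem_iff z).1 hz)).ne'
  rw [logGrad, partialDeriv_radial hz0 (h.hasDerivAt ((h.mem_iff z).1 hz)), logSlope]
  field_simp

lemma sum_logGrad_sq (h : IsRadialMetric M γ I F) {z : Cm m} (hz : z ∈ M) (hz0 : z ≠ 0) :
    ∑ k, logGrad (realBasis m) (fun y => F ‖y‖) k z ^ 2 = (logSlope F ‖z‖ / ‖z‖) ^ 2 := by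
  have hn : ‖z‖ ≠ 0 := norm_ne_zero_iff.mpr hz0
  simp only [h.logGrad_eq hz hz0, mul_pow, ← Finset.mul_sum, sum_repr_sq]
  field_simp

lemma tensionIdNorm_eq (h : IsRadialMetric M γ I F) (hm : 1 ≤ m) {z : Cm m} (hz : z ∈ M)
    (hz0 : z ≠ 0) :
    tensionIdNorm γ z = (m - 1 : ℝ) / 2 * (|deriv F ‖z‖| / (2 * F ‖z‖) / √(F ‖z‖)) := by
  have hF := h.pos _ ((h.mem_iff z).1 hz)
  have hn : ‖z‖ ≠ 0 := norm_ne_zero_iff.mpr hz0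
  have : logSlope F ‖z‖ / ‖z‖ = deriv F ‖z‖ / (2 * F ‖z‖) := by
    rw [logSlope]
    field_simp
  rw [tensionIdNorm_conformal hm h.isOpen_domain h.conformal hz, h.sum_logGrad_sq hz hz0,
    Real.sqrt_div (sq_nonneg _), Real.sqrt_sq_eq_abs, this, abs_div, abs_of_pos (by positivity :
      0 < 2 * F ‖z‖)]

lemma hasDerivAt_logSlope (h : IsRadialMetric M γ I F) {r : ℝ} (hr : r ∈ I) :
    HasDerivAt (logSlope F) (deriv (logSlope F) r) r := by
  have hF := (h.pos r hr).ne'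
  have : DifferentiableAt ℝ (fun r => r * deriv F r / (2 * F r)) r :=
    (differentiableAt_id.mul (h.differentiableAt_deriv hr)).div
      ((h.hasDerivAt hr).differentiableAt.const_mul 2) (by simpa using hF)
  exact this.hasDerivAt

/-- Nonpositivity of the curvature of the plane of the coordinates `p`, `q` at the point at
distance `r` from the origin on the axis of the coordinate `i`. Near this point `logGrad` is
`Q(|z|) z_k`; `Q'` is the derivative of `Q`, and `s k` is the square of the coordinate `k` of the
point. -/
lemma curvature_ineq (h : IsRadialMetric M γ I F)
    (hcurv : HasNonposSectionalCurvature (realBasis m) M (riemannian γ))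
    {r : ℝ} (hr : r ∈ I) (hr0 : 0 < r) {i p q : Fin 2 × Fin m} (hpq : p ≠ q) :
    let Q := logSlope F r / r ^ 2
    let Q' := (deriv (logSlope F) r * r ^ 2 - logSlope F r * (2 * r)) / (r ^ 2) ^ 2
    let s := fun k => if i = k then r ^ 2 else 0
    0 ≤ (Q + Q' / r * s p) + (Q + Q' / r * s q) - Q ^ 2 * s p - Q ^ 2 * s q + Q ^ 2 * r ^ 2 := by
  intro Q Q' s
  let z : Cm m := r • realBasis m i
  have hb : ‖realBasis m i‖ = 1 := by
    have := inner_realBasis_realBasis i i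
    rw [real_inner_self_eq_norm_sq, if_pos rfl] at this
    nlinarith [norm_nonneg (realBasis m i)]
  have hnz : ‖z‖ = r := by rw [norm_smul, hb, mul_one, Real.norm_of_nonneg hr0.le]
  have hz0 : z ≠ 0 := norm_ne_zero_iff.mp (by rw [hnz]; exact hr0.ne')
  have hz : z ∈ M := (h.mem_iff z).2 (by rwa [hnz])
  have hrepr : ∀ k, (realBasis m).repr z k ^ 2 = s k := by
    intro k
    simp only [z, s, map_smul, Module.Basis.repr_self, Finsupp.smul_apply, Finsupp.single_apply,
      smul_eq_mul]
    split_ifs <;> simp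
  have hQ : HasDerivAt (fun r => logSlope F r / r ^ 2) Q' ‖z‖ := by
    rw [hnz]
    have := (h.hasDerivAt_logSlope hr).fun_div (hasDerivAt_pow 2 r) (by positivity)
    simpa only [Nat.cast_ofNat, Nat.add_one_sub_one, pow_one] using this
  have hderiv : ∀ k, partialDeriv (realBasis m) k
      (logGrad (realBasis m) (fun y => F ‖y‖) k) z = Q + Q' / r * s k := by
    intro k
    have hev : logGrad (realBasis m) (fun y => F ‖y‖) k =ᶠ[nhds z]
        fun y => logSlope F ‖y‖ / ‖y‖ ^ 2 * (realBasis m).repr y k := by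
      filter_upwards [h.isOpen_domain.mem_nhds hz, isOpen_ne.mem_nhds hz0] with y hy hy0
      exact h.logGrad_eq hy hy0 k
    rw [partialDeriv_congr _ _ hev,
      partialDeriv_radial_mul_repr (G := fun r => logSlope F r / r ^ 2) hz0 hQ, hrepr, hnz]
  have key := hcurv.conformal (f := fun y => F ‖y‖) h.isOpen_domain
    (fun y hy => riemannian_conformal (h.eq y hy)) (fun y hy => (h.conformal y hy).1) hz hpq
  rw [hderiv, hderiv, h.sum_logGrad_sq hz hz0, h.logGrad_eq hz hz0, h.logGrad_eq hz hz0,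
    mul_pow, mul_pow, hrepr, hrepr, hnz] at key
  have hQr : (logSlope F r / r) ^ 2 = Q ^ 2 * r ^ 2 := by
    simp only [Q]
    field_simp
  rw [hQr] at key
  exact key

/-- Nonpositive curvature of the radial planes. -/
lemma monotoneOn_logSlope (h : IsRadialMetric M γ I F) (hm : 1 ≤ m)
    (hcurv : HasNonposSectionalCurvature (realBasis m) M (riemannian γ)) :
    MonotoneOn (logSlope F) (I ∩ Set.Ici 0) := by
  refine monotoneOn_of_deriv_nonneg h.ordConnected.convex
    (fun r hr => (h.hasDerivAt_logSlope hr.1).continuousAt.continuousWithinAt) ?_ ?_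
  · rw [h.interior_radii]
    exact fun r hr =>
      (h.hasDerivAt_logSlope hr.1).differentiableAt.differentiableWithinAt
  · rw [h.interior_radii]
    rintro r ⟨hr, hr0 : 0 < r⟩
    have key := h.curvature_ineq hcurv hr hr0 (i := (0, ⟨0, hm⟩)) (p := (0, ⟨0, hm⟩))
      (q := (1, ⟨0, hm⟩)) (by simp)
    simp at key
    field_simp at key
    exact nonneg_of_mul_nonneg_right (by linarith : 0 ≤ r * deriv (logSlope F) r) hr0

/-- Nonpositive curvature of the planes tangent to the spheres about the origin. -/
lemma logSlope_nonneg_or_le (h : IsRadialMetric M γ I F) (hm : 2 ≤ m)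
    (hcurv : HasNonposSectionalCurvature (realBasis m) M (riemannian γ))
    {r : ℝ} (hr : r ∈ I) (hr0 : 0 < r) : 0 ≤ logSlope F r ∨ logSlope F r ≤ -2 := by
  have key := h.curvature_ineq hcurv hr hr0 (i := (0, ⟨0, by omega⟩)) (p := (1, ⟨0, by omega⟩))
    (q := (0, ⟨1, by omega⟩)) (by simp)
  simp at key
  field_simp at key
  by_contra! hc
  nlinarith

end IsRadialMetric

end Radial

/-! ### The distance of a radial metric -/

section Distance

/-- The signed length of the radial segment from radius `r₀` to radius `r` for the metric with
conformal factor `F`. -/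
noncomputable def arcLength (F : ℝ → ℝ) (r₀ r : ℝ) : ℝ := ∫ t in r₀..r, √(F t)

variable {m : ℕ} {M : Set (Cm m)} {γ : Cm m → Matrix (Fin m) (Fin m) ℂ}

/-- If `c` has right derivative `c'` at `t` and `T` is differentiable at `|c t|`, the slopes of
`T(|c|)` to the right of `t` are asymptotically at most `|T'(|c t|)| |c'|`, although `|c|` need not
be differentiable where `c` vanishes. -/
lemma eventually_slope_comp_norm_lt {c : ℝ → Cm m} {c' : Cm m} {t T' r : ℝ} {T : ℝ → ℝ}
    (hc : HasDerivWithinAt c c' (Set.Ioi t) t) (hT : HasDerivAt T T' ‖c t‖)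
    (hr : |T'| * ‖c'‖ < r) :
    ∀ᶠ s in nhdsWithin t (Set.Ioi t), slope (fun s => T ‖c s‖) t s < r := by
  have h1 : Filter.Tendsto (fun s => ‖slope c t s‖) (nhdsWithin t (Set.Ioi t)) (nhds ‖c'‖) := by
    have := hasDerivWithinAt_iff_tendsto_slope' (by simp) |>.1 hc
    exact this.norm
  have h2 : Filter.Tendsto (fun s => |dslope T ‖c t‖ ‖c s‖|) (nhdsWithin t (Set.Ioi t))
      (nhds |T'|) := by
    have h3 : ContinuousAt (dslope T ‖c t‖) ‖c t‖ :=
      continuousAt_dslope_same.2 hT.differentiableAt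
    have h4 : Filter.Tendsto (fun s => dslope T ‖c t‖ ‖c s‖) (nhdsWithin t (Set.Ioi t))
        (nhds (dslope T ‖c t‖ ‖c t‖)) :=
      h3.tendsto.comp hc.continuousWithinAt.norm
    rw [dslope_same, hT.deriv] at h4
    exact h4.abs
  filter_upwards [(h2.mul h1).eventually_lt_const hr, self_mem_nhdsWithin] with s hs hts
  refine lt_of_le_of_lt ?_ hs
  have hpos : 0 < s - t := sub_pos.2 hts
  rw [slope_def_field, slope_def_module, norm_smul, norm_inv, Real.norm_of_nonneg hpos.le,
    div_le_iff₀ hpos, ← sub_smul_dslope T ‖c t‖ ‖c s‖]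
  calc (‖c s‖ - ‖c t‖) • dslope T ‖c t‖ ‖c s‖
      ≤ |(‖c s‖ - ‖c t‖) • dslope T ‖c t‖ ‖c s‖| := le_abs_self _
    _ = |dslope T ‖c t‖ ‖c s‖| * |‖c s‖ - ‖c t‖| := by rw [smul_eq_mul, abs_mul, mul_comm]
    _ ≤ |dslope T ‖c t‖ ‖c s‖| * ‖c s - c t‖ := by
      gcongr
      exact abs_norm_sub_norm_le _ _
    _ = |dslope T ‖c t‖ ‖c s‖| * ((s - t)⁻¹ * ‖c s - c t‖) * (s - t) := by
      field_simp

namespace IsRadialMetric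

variable {I : Set ℝ} {F : ℝ → ℝ}

lemma continuousOn_sqrt (h : IsRadialMetric M γ I F) : ContinuousOn (fun r => √(F r)) I :=
  h.smooth.continuousOn.sqrt

lemma realForm_self (h : IsRadialMetric M γ I F) {z : Cm m} (hz : z ∈ M) (v : Cm m) :
    √(realForm γ z v v) = √(F ‖z‖) * ‖v‖ := by
  rw [realForm_conformal (h.eq z hz), real_inner_self_eq_norm_sq,
    Real.sqrt_mul (h.conformal z hz).1.le, Real.sqrt_sq (norm_nonneg v)]

lemma curveLength_eq (h : IsRadialMetric M γ I F) {x y : Cm m} {c : ℝ → Cm m}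
    (hc : c ∈ curvesIn M x y) :
    ContinuousOn (fun t => √(F ‖c t‖) * ‖derivWithin c (Set.Icc 0 1) t‖) (Set.Icc 0 1) ∧
    curveLength γ c = ENNReal.ofReal
      (∫ t in (0 : ℝ)..1, √(F ‖c t‖) * ‖derivWithin c (Set.Icc 0 1) t‖) := by
  obtain ⟨hsmooth, hmaps, -, -⟩ := hc
  have hcont : ContinuousOn (fun t => √(F ‖c t‖) * ‖derivWithin c (Set.Icc 0 1) t‖)
      (Set.Icc 0 1) :=
    (h.continuousOn_sqrt.comp hsmooth.continuousOn.norm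
      fun t ht => (h.mem_iff _).1 (hmaps ht)).mul
      (hsmooth.continuousOn_derivWithin (uniqueDiffOn_Icc one_pos) le_rfl).norm
  refine ⟨hcont, ?_⟩
  rw [intervalIntegral.integral_of_le zero_le_one, ← MeasureTheory.integral_Icc_eq_integral_Ioc,
    MeasureTheory.ofReal_integral_eq_lintegral_ofReal hcont.integrableOn_Icc
      (Filter.Eventually.of_forall fun t => by positivity), curveLength]
  refine MeasureTheory.setLIntegral_congr_fun measurableSet_Icc fun t ht => ?_
  simp only [h.realForm_self (hmaps ht)]

/-- A function of the norm with gradient at most `√F` is `1`-Lipschitz for the Riemannian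
distance. -/
lemma ofReal_sub_le_riemEDist (h : IsRadialMetric M γ I F) {T T' : ℝ → ℝ}
    (hT : ∀ r ∈ I ∩ Set.Ici 0, HasDerivAt T (T' r) r)
    (hT' : ∀ r ∈ I ∩ Set.Ici 0, |T' r| ≤ √(F r)) (x y : Cm m) :
    ENNReal.ofReal (T ‖y‖ - T ‖x‖) ≤ riemEDist M γ x y := by
  refine le_iInf₂ fun c hc => ?_
  obtain ⟨hv, hlen⟩ := h.curveLength_eq hc
  rw [hlen]
  refine ENNReal.ofReal_le_ofReal ?_
  obtain ⟨hsmooth, hmaps, rfl, rfl⟩ := hc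
  set v := fun t => √(F ‖c t‖) * ‖derivWithin c (Set.Icc 0 1) t‖ with hv_def
  have hnorm : ∀ t ∈ Set.Icc (0 : ℝ) 1, ‖c t‖ ∈ I ∩ Set.Ici 0 := fun t ht =>
    ⟨(h.mem_iff _).1 (hmaps ht), norm_nonneg _⟩
  -- the speed, extended to a continuous function on the line
  let V : ℝ → ℝ := Set.IccExtend (zero_le_one' ℝ) ((Set.Icc 0 1).domRestrict v)
  have hV : Continuous V := (continuousOn_iff_continuous_domRestrict.1 hv).Icc_extend'
  have hVv : ∀ t ∈ Set.Icc (0 : ℝ) 1, V t = v t := fun t ht =>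
    Set.IccExtend_of_mem _ _ ht
  have hB : ∀ t, HasDerivAt (fun t => ∫ s in (0 : ℝ)..t, V s) (V t) t := fun t =>
    intervalIntegral.integral_hasDerivAt_right (hV.intervalIntegrable _ _)
      (hV.stronglyMeasurableAtFilter _ _) hV.continuousAt
  have hint : ∫ t in (0 : ℝ)..1, v t = ∫ t in (0 : ℝ)..1, V t := by
    refine intervalIntegral.integral_congr fun t ht => ?_
    rw [Set.uIcc_of_le zero_le_one] at ht
    exact (hVv t ht).symm
  have hTc : ContinuousOn (fun t => T ‖c t‖ - T ‖c 0‖) (Set.Icc 0 1) := by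
    refine ContinuousOn.sub ?_ continuousOn_const
    intro t ht
    exact (hT _ (hnorm t ht)).continuousAt.comp_continuousWithinAt (f := fun t => ‖c t‖)
      (hsmooth.continuousOn t ht).norm
  have key := image_le_of_liminf_slope_right_le_deriv_boundary hTc (B := fun t =>
    ∫ s in (0 : ℝ)..t, V s) (B' := V) (by simp)
    (fun t _ => (hB t).continuousAt.continuousWithinAt)
    (fun t _ => (hB t).hasDerivWithinAt) (by
      intro t ht r hr
      have ht' := Set.Ico_subset_Icc_self ht
      have hd : HasDerivWithinAt c (derivWithin c (Set.Icc 0 1) t) (Set.Ioi t) t := by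
        have h1 := (hsmooth.differentiableOn one_ne_zero t ht').hasDerivWithinAt
        exact (h1.mono_of_mem_nhdsWithin (Icc_mem_nhdsGE_of_mem ht)).mono
          Set.Ioi_subset_Ici_self
      have hlt : |T' ‖c t‖| * ‖derivWithin c (Set.Icc 0 1) t‖ < r := by
        refine lt_of_le_of_lt ?_ hr
        rw [hVv t ht', hv_def]
        exact mul_le_mul_of_nonneg_right (hT' _ (hnorm t ht')) (norm_nonneg _)
      have hev := eventually_slope_comp_norm_lt hd (hT _ (hnorm t ht')) hlt
      refine (hev.mono fun s hs => ?_).frequently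
      simpa [slope_def_field] using hs)
  rw [hint]
  exact key (Set.right_mem_Icc.2 zero_le_one)

lemma uIcc_subset (h : IsRadialMetric M γ I F) {r s : ℝ} (hr : r ∈ I ∩ Set.Ici 0)
    (hs : s ∈ I ∩ Set.Ici 0) : Set.uIcc r s ⊆ I ∩ Set.Ici 0 :=
  h.ordConnected.uIcc_subset hr hs

variable {r₀ : ℝ}

lemma hasDerivAt_arcLength (h : IsRadialMetric M γ I F) (hr₀ : r₀ ∈ I ∩ Set.Ici 0) {r : ℝ}
    (hr : r ∈ I ∩ Set.Ici 0) : HasDerivAt (arcLength F r₀) (√(F r)) r := by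
  refine intervalIntegral.integral_hasDerivAt_right ?_ ?_ ?_
  · exact (h.continuousOn_sqrt.mono fun t ht => (h.uIcc_subset hr₀ hr ht).1).intervalIntegrable
  · exact h.continuousOn_sqrt.stronglyMeasurableAtFilter h.isOpen r hr.1
  · exact h.continuousOn_sqrt.continuousAt (h.isOpen.mem_nhds hr.1)

lemma edist_arcLength_le (h : IsRadialMetric M γ I F) (hr₀ : r₀ ∈ I ∩ Set.Ici 0) (x y : Cm m) :
    edist (arcLength F r₀ ‖x‖) (arcLength F r₀ ‖y‖) ≤ riemEDist M γ x y := by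
  rw [edist_dist, Real.dist_eq]
  rcases le_total (arcLength F r₀ ‖y‖ - arcLength F r₀ ‖x‖) 0 with hle | hle
  · have := h.ofReal_sub_le_riemEDist (T := fun r => -arcLength F r₀ r)
      (fun r hr => (h.hasDerivAt_arcLength hr₀ hr).neg)
      (fun r hr => by rw [abs_neg, abs_of_nonneg (Real.sqrt_nonneg _)]) x y
    rw [abs_of_nonneg (by linarith)]
    convert this using 2
    ring
  · have := h.ofReal_sub_le_riemEDist (T := arcLength F r₀)
      (fun r hr => h.hasDerivAt_arcLength hr₀ hr)
      (fun r hr => by rw [abs_of_nonneg (Real.sqrt_nonneg _)]) x y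
    rw [abs_of_nonpos (by linarith)]
    convert this using 2
    ring

lemma riemEDist_smul_le (h : IsRadialMetric M γ I F) (hr₀ : r₀ ∈ I ∩ Set.Ici 0) {e : Cm m}
    (he : ‖e‖ = 1) {r s : ℝ} (hr : r ∈ I ∩ Set.Ici 0) (hs : s ∈ I ∩ Set.Ici 0) :
    riemEDist M γ (r • e) (s • e) ≤ edist (arcLength F r₀ r) (arcLength F r₀ s) := by
  let c : ℝ → Cm m := fun t => (r + t * (s - r)) • e
  have hseg : ∀ t ∈ Set.Icc (0 : ℝ) 1, r + t * (s - r) ∈ I ∩ Set.Ici 0 := by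
    intro t ht
    refine h.uIcc_subset hr hs ?_
    rw [← segment_eq_uIcc, segment_eq_image']
    exact ⟨t, ht, rfl⟩
  have hnorm : ∀ t ∈ Set.Icc (0 : ℝ) 1, ‖c t‖ = r + t * (s - r) := fun t ht => by
    rw [norm_smul, he, mul_one, Real.norm_of_nonneg (hseg t ht).2]
  have hc : c ∈ curvesIn M (r • e) (s • e) := by
    refine ⟨?_, fun t ht => ?_, by simp [c], by simp [c]⟩
    · exact ContDiff.contDiffOn (by fun_prop)
    · rw [h.mem_iff, hnorm t ht]
      exact (hseg t ht).1
  have hd : ∀ t ∈ Set.Icc (0 : ℝ) 1, ‖derivWithin c (Set.Icc 0 1) t‖ = |s - r| := by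
    intro t ht
    have h1 : HasDerivAt (fun t : ℝ => r + t * (s - r)) (1 * (s - r)) t :=
      ((hasDerivAt_id t).mul_const (s - r)).const_add r
    have h2 : HasDerivAt c ((1 * (s - r)) • e) t := h1.smul_const e
    rw [h2.hasDerivWithinAt.derivWithin (uniqueDiffOn_Icc one_pos t ht), norm_smul, he, one_mul,
      mul_one, Real.norm_eq_abs]
  have hint : ∫ t in (0 : ℝ)..1, √(F (r + t * (s - r))) * (s - r)
      = arcLength F r₀ s - arcLength F r₀ r := by
    have h3 : ∀ t ∈ Set.uIcc (0 : ℝ) 1, HasDerivAt (fun t => arcLength F r₀ (r + t * (s - r)))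
        (√(F (r + t * (s - r))) * (s - r)) t := by
      intro t ht
      rw [Set.uIcc_of_le zero_le_one] at ht
      have h1 : HasDerivAt (fun t : ℝ => r + t * (s - r)) (1 * (s - r)) t :=
        ((hasDerivAt_id t).mul_const (s - r)).const_add r
      rw [one_mul] at h1
      exact (h.hasDerivAt_arcLength hr₀ (hseg t ht)).comp t h1
    rw [intervalIntegral.integral_eq_sub_of_hasDerivAt h3]
    · simp
    · refine ContinuousOn.intervalIntegrable ?_
      rw [Set.uIcc_of_le zero_le_one]
      exact (h.continuousOn_sqrt.comp (by fun_prop) fun t ht => (hseg t ht).1).mul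
        continuousOn_const
  have hlen : (∫ t in (0 : ℝ)..1, √(F ‖c t‖) * ‖derivWithin c (Set.Icc 0 1) t‖)
      = ∫ t in (0 : ℝ)..1, √(F (r + t * (s - r))) * |s - r| := by
    refine intervalIntegral.integral_congr fun t ht => ?_
    rw [Set.uIcc_of_le zero_le_one] at ht
    simp only [hnorm t ht, hd t ht]
  refine (iInf₂_le c hc).trans ?_
  rw [(h.curveLength_eq hc).2, hlen, edist_dist, Real.dist_eq]
  refine ENNReal.ofReal_le_ofReal ?_
  rw [intervalIntegral.integral_mul_const] at hint ⊢
  rcases le_total r s with hrs | hrs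
  · rw [abs_of_nonneg (sub_nonneg.2 hrs), hint, abs_sub_comm]
    exact le_abs_self _
  · rw [abs_of_nonpos (sub_nonpos.2 hrs), mul_neg, hint, neg_sub]
    exact le_abs_self _

/-! ### Completeness -/

/-- Points on a ray whose arc lengths form a Cauchy sequence form a Cauchy sequence in `M`, and the
arc length of the norm of its limit is the limit of the arc lengths. -/
lemma isClosed_image_arcLength (h : IsRadialMetric M γ I F) (hm : 1 ≤ m)
    (hcomplete : IsCompleteMetric M γ) (hr₀ : r₀ ∈ I ∩ Set.Ici 0) :
    IsClosed (arcLength F r₀ '' (I ∩ Set.Ici 0)) := by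
  let e : Cm m := EuclideanSpace.single ⟨0, hm⟩ 1
  have he : ‖e‖ = 1 := by simp [e]
  have hnorm : ∀ r : ℝ, 0 ≤ r → ‖r • e‖ = r := fun r hr => by
    rw [norm_smul, he, mul_one, Real.norm_of_nonneg hr]
  refine IsSeqClosed.isClosed fun u l hu hl => ?_
  choose ρ hρ hρu using hu
  obtain ⟨y, hy, hlim⟩ := hcomplete (fun n => ρ n • e)
    (fun n => by rw [h.mem_iff, hnorm _ (hρ n).2]; exact (hρ n).1) (by
      intro ε hε
      obtain ⟨N, hN⟩ := EMetric.cauchySeq_iff.1 hl.cauchySeq ε hε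
      refine ⟨N, fun n hn k hk => lt_of_le_of_lt ?_ (hN n hn k hk)⟩
      rw [← hρu n, ← hρu k]
      exact h.riemEDist_smul_le hr₀ he (hρ n) (hρ k))
  refine ⟨‖y‖, ⟨(h.mem_iff y).1 hy, norm_nonneg y⟩, ?_⟩
  refine tendsto_nhds_unique (tendsto_iff_edist_tendsto_0.2 ?_) hl
  refine tendsto_of_tendsto_of_tendsto_of_le_of_le tendsto_const_nhds hlim
    (fun n => zero_le) fun n => ?_
  have := h.edist_arcLength_le hr₀ (ρ n • e) y
  rwa [hnorm _ (hρ n).2, hρu n] at this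

lemma strictMonoOn_arcLength (h : IsRadialMetric M γ I F) (hr₀ : r₀ ∈ I ∩ Set.Ici 0) :
    StrictMonoOn (arcLength F r₀) (I ∩ Set.Ici 0) := by
  refine strictMonoOn_of_deriv_pos h.ordConnected.convex
    (fun r hr => (h.hasDerivAt_arcLength hr₀ hr).continuousAt.continuousWithinAt) fun r hr => ?_
  have hr' := interior_subset hr
  rw [(h.hasDerivAt_arcLength hr₀ hr').deriv]
  exact Real.sqrt_pos.2 (h.pos r hr'.1)

/-- Rays of a complete radial metric have infinite length. -/
lemma not_bddAbove_arcLength (h : IsRadialMetric M γ I F) (hm : 1 ≤ m)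
    (hcomplete : IsCompleteMetric M γ) (hr₀ : r₀ ∈ I ∩ Set.Ici 0) :
    ¬ BddAbove (arcLength F r₀ '' (I ∩ Set.Ici 0)) := by
  intro hb
  obtain ⟨ρ, hρ, hρs⟩ := (h.isClosed_image_arcLength hm hcomplete hr₀).csSup_mem
    (h.nonempty.image _) hb
  -- the supremum is attained at `ρ`, but `I` contains larger radii
  obtain ⟨ρ', hρ', hlt⟩ : (I ∩ Set.Ioi ρ).Nonempty := Filter.nonempty_of_mem
    (Filter.inter_mem (mem_nhdsWithin_of_mem_nhds (h.isOpen.mem_nhds hρ.1)) self_mem_nhdsWithin)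
  have hρ'' : ρ' ∈ I ∩ Set.Ici 0 := ⟨hρ', (Set.mem_Ici.1 hρ.2).trans (le_of_lt hlt)⟩
  have h1 := h.strictMonoOn_arcLength hr₀ hρ hρ'' hlt
  have h2 := le_csSup hb (Set.mem_image_of_mem _ hρ'')
  linarith

/-- If the domain of a complete radial metric omits the origin, radial segments towards the origin
have infinite length. -/
lemma not_bddBelow_arcLength (h : IsRadialMetric M γ I F) (hm : 1 ≤ m)
    (hcomplete : IsCompleteMetric M γ) (hr₀ : r₀ ∈ I ∩ Set.Ici 0) (h0 : (0 : ℝ) ∉ I) :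
    ¬ BddBelow (arcLength F r₀ '' (I ∩ Set.Ici 0)) := by
  intro hb
  obtain ⟨ρ, hρ, hρs⟩ := (h.isClosed_image_arcLength hm hcomplete hr₀).csInf_mem
    (h.nonempty.image _) hb
  have hρ0 : 0 < ρ := lt_of_le_of_ne hρ.2 fun h' => h0 (h' ▸ hρ.1)
  obtain ⟨ρ', ⟨hρ', hpos : 0 < ρ'⟩, hlt⟩ : ((I ∩ Set.Ioi 0) ∩ Set.Iio ρ).Nonempty :=
    Filter.nonempty_of_mem (Filter.inter_mem (mem_nhdsWithin_of_mem_nhds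
      (Filter.inter_mem (h.isOpen.mem_nhds hρ.1) (Ioi_mem_nhds hρ0))) self_mem_nhdsWithin)
  have hρ'' : ρ' ∈ I ∩ Set.Ici 0 := ⟨hρ', hpos.le⟩
  have h1 := h.strictMonoOn_arcLength hr₀ hρ'' hρ hlt
  have h2 := csInf_le hb (Set.mem_image_of_mem _ hρ'')
  linarith

end IsRadialMetric

end Distance

/-! ### The domain contains the origin -/

section Rigidity

variable {m : ℕ} {M : Set (Cm m)} {γ : Cm m → Matrix (Fin m) (Fin m) ℂ}

namespace IsRadialMetric

variable {I : Set ℝ} {F : ℝ → ℝ}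

lemma deriv_eq (h : IsRadialMetric M γ I F) {r : ℝ} (hr : r ∈ I) (hr0 : 0 < r) :
    deriv F r = 2 * F r * logSlope F r / r := by
  have := (h.pos r hr).ne'
  rw [logSlope]
  field_simp

lemma monotoneOn_of_logSlope_nonneg (h : IsRadialMetric M γ I F)
    (hp : ∀ r ∈ I ∩ Set.Ici 0, 0 ≤ logSlope F r) : MonotoneOn F (I ∩ Set.Ici 0) := by
  refine monotoneOn_of_deriv_nonneg h.ordConnected.convex
    (h.smooth.continuousOn.mono Set.inter_subset_left) (fun r hr =>
      (h.hasDerivAt (interior_subset hr).1).differentiableAt.differentiableWithinAt) ?_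
  rw [h.interior_radii]
  rintro r ⟨hr, hr0 : 0 < r⟩
  rw [h.deriv_eq hr hr0]
  have h1 := h.pos r hr
  have h2 := hp r ⟨hr, hr0.le⟩
  positivity

lemma arcLength_self (r : ℝ) : arcLength F r r = 0 := intervalIntegral.integral_same

lemma abs_arcLength_le {r₀ r K : ℝ} (hK : ∀ t ∈ Set.uIcc r₀ r, F t ≤ K) :
    |arcLength F r₀ r| ≤ √K * |r - r₀| := by
  rw [arcLength, ← Real.norm_eq_abs]
  refine intervalIntegral.norm_integral_le_of_norm_le_const fun t ht => ?_
  rw [Real.norm_of_nonneg (Real.sqrt_nonneg _)]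
  exact Real.sqrt_le_sqrt (hK t (Set.uIoc_subset_uIcc ht))

/-- If `logSlope F ≤ -2`, then `√F(r) ≤ K / r²`, so that rays have finite length. -/
lemma bddAbove_arcLength (h : IsRadialMetric M γ I F) (h0 : (0 : ℝ) ∉ I)
    (hp : ∀ r ∈ I ∩ Set.Ici 0, logSlope F r ≤ -2) {r₀ : ℝ} (hr₀ : r₀ ∈ I ∩ Set.Ici 0) :
    BddAbove (arcLength F r₀ '' (I ∩ Set.Ici 0)) := by
  have hpos : ∀ r ∈ I ∩ Set.Ici 0, 0 < r := fun r hr =>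
    lt_of_le_of_ne hr.2 fun h' => h0 (h' ▸ hr.1)
  have hanti : AntitoneOn (fun r => r ^ 4 * F r) (I ∩ Set.Ici 0) := by
    have hd : ∀ r ∈ I ∩ Set.Ici 0, HasDerivAt (fun r => r ^ 4 * F r)
        (4 * r ^ 3 * F r + r ^ 4 * deriv F r) r := fun r hr => by
      simpa using (hasDerivAt_pow 4 r).fun_mul (h.hasDerivAt hr.1)
    refine antitoneOn_of_deriv_nonpos h.ordConnected.convex
      (fun r hr => (hd r hr).continuousAt.continuousWithinAt)
      (fun r hr => (hd r (interior_subset hr)).differentiableAt.differentiableWithinAt)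
      fun r hr => ?_
    have hr' := interior_subset hr
    have hr0 := hpos r hr'
    have hF := h.pos r hr'.1
    rw [(hd r hr').deriv, h.deriv_eq hr'.1 hr0]
    have : 4 * r ^ 3 * F r + r ^ 4 * (2 * F r * logSlope F r / r)
        = 2 * r ^ 3 * F r * (2 + logSlope F r) := by
      field_simp
      ring
    rw [this]
    exact mul_nonpos_of_nonneg_of_nonpos (by positivity) (by linarith [hp r hr'])
  set K := √(r₀ ^ 4 * F r₀) with hK
  have hr₀pos := hpos r₀ hr₀
  have hanti2 : AntitoneOn (fun r => arcLength F r₀ r + K / r) ((I ∩ Set.Ici 0) ∩ Set.Ici r₀) := by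
    have hd : ∀ r ∈ I ∩ Set.Ici 0, HasDerivAt (fun r => arcLength F r₀ r + K / r)
        (√(F r) + K * (-(r ^ 2)⁻¹)) r := fun r hr => by
      simpa only [div_eq_mul_inv] using (h.hasDerivAt_arcLength hr₀ hr).fun_add
        ((hasDerivAt_inv (hpos r hr).ne').const_mul K)
    refine antitoneOn_of_deriv_nonpos (h.ordConnected.inter Set.ordConnected_Ici).convex
      (fun r hr => (hd r hr.1).continuousAt.continuousWithinAt)
      (fun r hr => (hd r (interior_subset hr).1).differentiableAt.differentiableWithinAt)
      fun r hr => ?_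
    have hr' := interior_subset hr
    have hr0 := hpos r hr'.1
    rw [(hd r hr'.1).deriv]
    have h1 : √(r ^ 4 * F r) ≤ K := Real.sqrt_le_sqrt (hanti hr₀ hr'.1 hr'.2)
    have h2 : √(r ^ 4 * F r) = r ^ 2 * √(F r) := by
      rw [Real.sqrt_mul (by positivity), show r ^ 4 = (r ^ 2) ^ 2 by ring,
        Real.sqrt_sq (by positivity)]
    rw [h2] at h1
    have h3 : √(F r) ≤ K / r ^ 2 := by
      rw [le_div_iff₀ (by positivity)]
      linarith
    rw [mul_neg, ← div_eq_mul_inv]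
    linarith
  refine ⟨K / r₀, ?_⟩
  rintro _ ⟨r, hr, rfl⟩
  have hK0 : 0 ≤ K := Real.sqrt_nonneg _
  rcases le_total r₀ r with hle | hle
  · have := hanti2 ⟨hr₀, Set.self_mem_Ici⟩ ⟨hr, hle⟩ hle
    simp only [arcLength_self, zero_add] at this
    have h4 : 0 ≤ K / r := div_nonneg hK0 (hpos r hr).le
    linarith
  · have h5 := (h.strictMonoOn_arcLength hr₀).monotoneOn hr hr₀ hle
    rw [arcLength_self] at h5
    exact h5.trans (div_nonneg hK0 hr₀pos.le)

/-- A shell is impossible: `logSlope F` is `≥ 0` everywhere or `≤ -2` everywhere; in the first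
case `F` is bounded near the inner end, in the second `√F` is integrable at the outer end. -/
theorem zero_mem (h : IsRadialMetric M γ I F) (hm : 2 ≤ m)
    (hcomplete : IsCompleteMetric M γ)
    (hcurv : HasNonposSectionalCurvature (realBasis m) M (riemannian γ)) : (0 : ℝ) ∈ I := by
  by_contra h0
  have hpos : ∀ r ∈ I ∩ Set.Ici 0, 0 < r := fun r hr =>
    lt_of_le_of_ne hr.2 fun h' => h0 (h' ▸ hr.1)
  obtain ⟨r₀, hr₀⟩ := h.nonempty
  have hdich : ∀ r ∈ I ∩ Set.Ici 0, 0 ≤ logSlope F r ∨ logSlope F r ≤ -2 := fun r hr =>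
    h.logSlope_nonneg_or_le hm hcurv hr.1 (hpos r hr)
  have himage : (logSlope F '' (I ∩ Set.Ici 0)).OrdConnected :=
    (h.ordConnected.isPreconnected.image _ fun r hr =>
      (h.hasDerivAt_logSlope hr.1).continuousAt.continuousWithinAt).ordConnected
  have hglobal : (∀ r ∈ I ∩ Set.Ici 0, 0 ≤ logSlope F r) ∨
      ∀ r ∈ I ∩ Set.Ici 0, logSlope F r ≤ -2 := by
    by_contra! hc
    obtain ⟨⟨r, hr, hr1⟩, s, hs, hs1⟩ := hc
    have hr2 := (hdich r hr).resolve_left hr1.not_ge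
    have hs2 := (hdich s hs).resolve_right hs1.not_ge
    obtain ⟨t, ht, ht1⟩ := himage.out ⟨r, hr, rfl⟩ ⟨s, hs, rfl⟩
      (⟨by linarith, by linarith⟩ : (-1 : ℝ) ∈ Set.Icc (logSlope F r) (logSlope F s))
    rcases hdich t ht with h1 | h1 <;> linarith
  rcases hglobal with hp | hp
  · refine h.not_bddBelow_arcLength (by omega) hcomplete hr₀ h0 ⟨-(√(F r₀) * r₀), ?_⟩
    rintro _ ⟨r, hr, rfl⟩
    rcases le_total r₀ r with hle | hle
    · have h1 := (h.strictMonoOn_arcLength hr₀).monotoneOn hr₀ hr hle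
      rw [arcLength_self] at h1
      have h2 : 0 ≤ √(F r₀) * r₀ := mul_nonneg (Real.sqrt_nonneg _) hr₀.2
      linarith
    · have h1 : |arcLength F r₀ r| ≤ √(F r₀) * |r - r₀| := by
        refine abs_arcLength_le fun t ht => ?_
        have ht' := h.uIcc_subset hr₀ hr ht
        rw [Set.uIcc_of_ge hle] at ht
        exact h.monotoneOn_of_logSlope_nonneg hp ht' hr₀ ht.2
      have h2 : √(F r₀) * |r - r₀| ≤ √(F r₀) * r₀ := by
        refine mul_le_mul_of_nonneg_left ?_ (Real.sqrt_nonneg _)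
        rw [abs_of_nonpos (by linarith)]
        linarith [hpos r hr]
      linarith [neg_abs_le (arcLength F r₀ r)]
  · exact h.not_bddAbove_arcLength (by omega) hcomplete hr₀ (h.bddAbove_arcLength h0 hp hr₀)

lemma logSlope_nonneg (h : IsRadialMetric M γ I F) (hm : 1 ≤ m) (h0 : (0 : ℝ) ∈ I)
    (hcurv : HasNonposSectionalCurvature (realBasis m) M (riemannian γ)) :
    ∀ r ∈ I ∩ Set.Ici 0, 0 ≤ logSlope F r := by
  intro r hr
  have := h.monotoneOn_logSlope hm hcurv ⟨h0, Set.self_mem_Ici⟩ hr hr.2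
  simpa [logSlope] using this

/-! ### Boundedness of the conformal factor -/

lemma riemEDist_smul_eq (h : IsRadialMetric M γ I F) {r₀ : ℝ} (hr₀ : r₀ ∈ I ∩ Set.Ici 0)
    {e : Cm m} (he : ‖e‖ = 1) {r s : ℝ} (hr : r ∈ I ∩ Set.Ici 0) (hs : s ∈ I ∩ Set.Ici 0) :
    riemEDist M γ (r • e) (s • e) = edist (arcLength F r₀ r) (arcLength F r₀ s) := by
  refine le_antisymm (h.riemEDist_smul_le hr₀ he hr hs) ?_
  have := h.edist_arcLength_le hr₀ (r • e) (s • e)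
  rwa [norm_smul, norm_smul, he, mul_one, mul_one, Real.norm_of_nonneg hr.2,
    Real.norm_of_nonneg hs.2] at this

/-- The decay condition along the ray through the base point. -/
lemma exists_deriv_le_of_decay (h : IsRadialMetric M γ I F) (hm : 2 ≤ m) {lam : ℝ}
    (hdecay : tensionIdNorm γ ∈ DecayC0 M γ lam) :
    ∃ r₀ ∈ I ∩ Set.Ici 0, ∃ C, 0 ≤ C ∧ ∀ r ∈ I ∩ Set.Ici 0, r₀ < r →
      deriv F r / (2 * F r) ≤ C * ((1 + arcLength F r₀ r) ^ (-lam) * √(F r)) := by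
  obtain ⟨-, z₀, hz₀, C, hC⟩ := hdecay
  obtain ⟨e, he, hez⟩ : ∃ e : Cm m, ‖e‖ = 1 ∧ z₀ = ‖z₀‖ • e := by
    by_cases hz : z₀ = 0
    · exact ⟨EuclideanSpace.single ⟨0, by omega⟩ 1, by simp, by simp [hz]⟩
    · have hn : ‖z₀‖ ≠ 0 := norm_ne_zero_iff.mpr hz
      exact ⟨‖z₀‖⁻¹ • z₀, by rw [norm_smul, norm_inv, norm_norm, inv_mul_cancel₀ hn],
        by rw [smul_smul, mul_inv_cancel₀ hn, one_smul]⟩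
  set r₀ := ‖z₀‖ with hr₀_def
  have hr₀ : r₀ ∈ I ∩ Set.Ici 0 := ⟨(h.mem_iff z₀).1 hz₀, norm_nonneg z₀⟩
  have hm1 : (0 : ℝ) < (m - 1) / 2 := by
    have : (2 : ℝ) ≤ m := by exact_mod_cast hm
    linarith
  have hC0 : 0 ≤ C := by
    have h1 := (abs_nonneg _).trans (hC z₀ hz₀)
    exact nonneg_of_mul_nonneg_left h1 (Real.rpow_pos_of_pos (by positivity) _)
  refine ⟨r₀, hr₀, C / ((m - 1) / 2), div_nonneg hC0 hm1.le, fun r hr hlt => ?_⟩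
  have hr0 : 0 < r := lt_of_le_of_lt hr₀.2 hlt
  have hnorm : ‖r • e‖ = r := by rw [norm_smul, he, mul_one, Real.norm_of_nonneg hr.2]
  have hmem : r • e ∈ M := (h.mem_iff _).2 (by rw [hnorm]; exact hr.1)
  have hne : r • e ≠ 0 := norm_ne_zero_iff.mp (by rw [hnorm]; exact hr0.ne')
  have hF := h.pos r hr.1
  have hS := (h.strictMonoOn_arcLength hr₀).monotoneOn hr₀ hr hlt.le
  rw [arcLength_self] at hS
  have hdist : (riemEDist M γ (r • e) z₀).toReal = arcLength F r₀ r := by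
    rw [hez, h.riemEDist_smul_eq hr₀ he hr hr₀, arcLength_self, edist_dist,
      ENNReal.toReal_ofReal dist_nonneg, Real.dist_eq, sub_zero, abs_of_nonneg hS]
  have key := (le_abs_self _).trans (hC _ hmem)
  rw [hdist, h.tensionIdNorm_eq (by omega) hmem hne, hnorm] at key
  calc deriv F r / (2 * F r) ≤ |deriv F r| / (2 * F r) := by
        gcongr
        exact le_abs_self _
    _ = ((m - 1) / 2 * (|deriv F r| / (2 * F r) / √(F r))) / ((m - 1) / 2) * √(F r) := by
        rw [mul_div_cancel_left₀ _ hm1.ne', div_mul_cancel₀ _ (Real.sqrt_pos.2 hF).ne']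
    _ ≤ (C * (1 + arcLength F r₀ r) ^ (-lam)) / ((m - 1) / 2) * √(F r) := by gcongr
    _ = C / ((m - 1) / 2) * ((1 + arcLength F r₀ r) ^ (-lam) * √(F r)) := by ring

/-- Along rays the derivative of `log F / 2` is at most a constant times that of
`-(1 + s)^{1-λ}`, where `s` is the arc length. -/
theorem exists_bound (h : IsRadialMetric M γ I F) (hm : 2 ≤ m) {lam : ℝ} (hlam : 1 < lam)
    (hdecay : tensionIdNorm γ ∈ DecayC0 M γ lam)
    (hp : ∀ r ∈ I ∩ Set.Ici 0, 0 ≤ logSlope F r) : ∃ K, ∀ r ∈ I ∩ Set.Ici 0, F r ≤ K := by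
  obtain ⟨r₀, hr₀, C, hC0, hC⟩ := h.exists_deriv_le_of_decay hm hdecay
  have hS : ∀ r ∈ (I ∩ Set.Ici 0) ∩ Set.Ici r₀, 0 < 1 + arcLength F r₀ r := by
    intro r hr
    have := (h.strictMonoOn_arcLength hr₀).monotoneOn hr₀ hr.1 hr.2
    rw [arcLength_self] at this
    linarith
  let Φ : ℝ → ℝ := fun r =>
    Real.log (F r) / 2 + C / (lam - 1) * (1 + arcLength F r₀ r) ^ (1 - lam)
  have hd : ∀ r ∈ (I ∩ Set.Ici 0) ∩ Set.Ici r₀, HasDerivAt Φ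
      (deriv F r / (2 * F r) - C * ((1 + arcLength F r₀ r) ^ (-lam) * √(F r))) r := by
    intro r hr
    have hF := (h.pos r hr.1.1).ne'
    have h1 := ((h.hasDerivAt hr.1.1).log hF).div_const 2
    have h2 := (((h.hasDerivAt_arcLength hr₀ hr.1).const_add 1).rpow_const (p := 1 - lam)
      (Or.inl (hS r hr).ne')).const_mul (C / (lam - 1))
    refine (h1.add h2).congr_deriv ?_
    have hl : lam - 1 ≠ 0 := by linarith
    rw [show 1 - lam - 1 = -lam by ring]
    field_simp
    ring
  have hanti : AntitoneOn Φ ((I ∩ Set.Ici 0) ∩ Set.Ici r₀) := by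
    refine antitoneOn_of_deriv_nonpos (h.ordConnected.inter Set.ordConnected_Ici).convex
      (fun r hr => (hd r hr).continuousAt.continuousWithinAt)
      (fun r hr => (hd r (interior_subset hr)).differentiableAt.differentiableWithinAt)
      fun r hr => ?_
    have hr' := interior_subset hr
    have hlt : r₀ < r := by
      rw [interior_inter, interior_Ici] at hr
      exact hr.2
    rw [(hd r hr').deriv]
    linarith [hC r hr'.1 hlt]
  have hbound : ∀ r ∈ (I ∩ Set.Ici 0) ∩ Set.Ici r₀, F r ≤ Real.exp (2 * Φ r₀) := by
    intro r hr
    have h1 := hanti ⟨hr₀, Set.self_mem_Ici⟩ hr hr.2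
    have h2 : 0 ≤ C / (lam - 1) * (1 + arcLength F r₀ r) ^ (1 - lam) :=
      mul_nonneg (div_nonneg hC0 (by linarith)) (Real.rpow_nonneg (hS r hr).le _)
    rw [← Real.log_le_iff_le_exp (h.pos r hr.1.1)]
    have h3 : Φ r = Real.log (F r) / 2
      + C / (lam - 1) * (1 + arcLength F r₀ r) ^ (1 - lam) := rfl
    linarith
  refine ⟨Real.exp (2 * Φ r₀), fun r hr => ?_⟩
  rcases le_total r₀ r with hle | hle
  · exact hbound r ⟨hr, hle⟩
  · exact (h.monotoneOn_of_logSlope_nonneg hp hr hr₀ hle).trans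
      (hbound r₀ ⟨hr₀, Set.self_mem_Ici⟩)

/-! ### Rigidity -/

lemma Ici_subset_of_bound (h : IsRadialMetric M γ I F) (hm : 1 ≤ m)
    (hcomplete : IsCompleteMetric M γ) (h0 : (0 : ℝ) ∈ I) {K : ℝ}
    (hK : ∀ r ∈ I ∩ Set.Ici 0, F r ≤ K) : Set.Ici 0 ⊆ I := by
  intro R hR
  have hR0 : 0 ≤ R := hR
  have h0' : (0 : ℝ) ∈ I ∩ Set.Ici 0 := ⟨h0, Set.self_mem_Ici⟩
  by_contra hRI
  refine h.not_bddAbove_arcLength hm hcomplete h0' ⟨√K * R, ?_⟩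
  rintro _ ⟨r, hr, rfl⟩
  have hrR : r ≤ R := by
    by_contra! hlt
    exact hRI (h.ordConnected.out h0' hr ⟨hR0, hlt.le⟩).1
  calc arcLength F 0 r ≤ |arcLength F 0 r| := le_abs_self _
    _ ≤ √K * |r - 0| := abs_arcLength_le fun t ht => hK t (h.uIcc_subset h0' hr ht)
    _ ≤ √K * R := by
      rw [sub_zero, abs_of_nonneg hr.2]
      exact mul_le_mul_of_nonneg_left hrR (Real.sqrt_nonneg _)

/-- If the monotone function `logSlope F` took a value `ε > 0`, then `F` would grow at least like
`r ^ (2 ε)`. -/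
lemma logSlope_nonpos_of_bound (h : IsRadialMetric M γ I F) (hI : Set.Ici 0 ⊆ I)
    (hmono : MonotoneOn (logSlope F) (I ∩ Set.Ici 0)) {K : ℝ}
    (hK : ∀ r ∈ I ∩ Set.Ici 0, F r ≤ K) {r₁ : ℝ} (hr₁ : 0 < r₁) : logSlope F r₁ ≤ 0 := by
  by_contra! hε
  set ε := logSlope F r₁ with hε_def
  have hJ : ∀ r ∈ Set.Ici r₁, r ∈ I ∩ Set.Ici 0 := fun r hr =>
    ⟨hI (hr₁.le.trans hr), hr₁.le.trans hr⟩
  have hd : ∀ r ∈ Set.Ici r₁, HasDerivAt (fun r => Real.log (F r) / 2 - ε * Real.log r)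
      (deriv F r / F r / 2 - ε * r⁻¹) r := fun r hr =>
    (((h.hasDerivAt (hJ r hr).1).log (h.pos r (hJ r hr).1).ne').div_const 2).fun_sub
      ((Real.hasDerivAt_log (hr₁.trans_le hr).ne').const_mul ε)
  have hmono2 : MonotoneOn (fun r => Real.log (F r) / 2 - ε * Real.log r) (Set.Ici r₁) := by
    refine monotoneOn_of_deriv_nonneg (convex_Ici r₁)
      (fun r hr => (hd r hr).continuousAt.continuousWithinAt)
      (fun r hr => (hd r (interior_subset hr)).differentiableAt.differentiableWithinAt)
      fun r hr => ?_
    have hr' := interior_subset hr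
    have hr0 : 0 < r := hr₁.trans_le hr'
    have hF := h.pos r (hJ r hr').1
    have hle : ε ≤ logSlope F r := hmono (hJ r₁ Set.self_mem_Ici) (hJ r hr') hr'
    rw [(hd r hr').deriv, h.deriv_eq (hJ r hr').1 hr0]
    have : 2 * F r * logSlope F r / r / F r / 2 - ε * r⁻¹ = (logSlope F r - ε) / r := by
      field_simp
    rw [this]
    exact div_nonneg (by linarith) hr0.le
  set A := (Real.log K / 2 - (Real.log (F r₁) / 2 - ε * Real.log r₁)) / ε with hA
  obtain ⟨r, hr, hAr⟩ := ((Filter.eventually_ge_atTop r₁).and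
    (Real.tendsto_log_atTop.eventually_gt_atTop A)).exists
  have h1 := hmono2 Set.self_mem_Ici hr hr
  simp only at h1
  have h2 : Real.log (F r) ≤ Real.log K :=
    Real.log_le_log (h.pos r (hJ r hr).1) (hK r (hJ r hr))
  rw [hA, div_lt_iff₀ hε] at hAr
  linarith

theorem eq_const (h : IsRadialMetric M γ I F) (hI : Set.Ici 0 ⊆ I)
    (hp : ∀ r ∈ I ∩ Set.Ici 0, 0 ≤ logSlope F r)
    (hmono : MonotoneOn (logSlope F) (I ∩ Set.Ici 0)) {K : ℝ}
    (hK : ∀ r ∈ I ∩ Set.Ici 0, F r ≤ K) {r : ℝ} (hr : 0 ≤ r) : F r = F 0 := by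
  have hanti : AntitoneOn F (I ∩ Set.Ici 0) := by
    refine antitoneOn_of_deriv_nonpos h.ordConnected.convex
      (h.smooth.continuousOn.mono Set.inter_subset_left) (fun r hr =>
        (h.hasDerivAt (interior_subset hr).1).differentiableAt.differentiableWithinAt) ?_
    rw [h.interior_radii]
    rintro r ⟨hr, hr0 : 0 < r⟩
    rw [h.deriv_eq hr hr0]
    have h1 := h.logSlope_nonpos_of_bound hI hmono hK hr0
    have h2 := h.pos r hr
    exact div_nonpos_of_nonpos_of_nonneg
      (mul_nonpos_of_nonneg_of_nonpos (by positivity) h1) hr0.le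
  have h0' : (0 : ℝ) ∈ I ∩ Set.Ici 0 := ⟨hI Set.self_mem_Ici, Set.self_mem_Ici⟩
  exact le_antisymm (hanti h0' ⟨hI hr, hr⟩ hr)
    (h.monotoneOn_of_logSlope_nonneg hp h0' ⟨hI hr, hr⟩ hr)

end IsRadialMetric

end Rigidity

end HermitianGeometry

open HermitianGeometry
theorem mainTheorem7 (m : ℕ) (hm : 2 ≤ m)
    (M : Set (EuclideanSpace ℂ (Fin m))) (hMopen : IsOpen M) (hMconn : IsConnected M)
    (γ : EuclideanSpace ℂ (Fin m) → Matrix (Fin m) (Fin m) ℂ)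
    (hγ : IsHermitianMetric M γ)
    (hconf : IsConformalToEuclidean M γ)
    (hrot : IsRotationallySymmetric M γ)
    (hcomplete : IsCompleteMetric M γ)
    (hcurv : HasNonposSectionalCurvature (realBasis m) M (riemannian γ))
    (lam : ℝ) (hlam : 1 < lam)
    (hdecay : tensionIdNorm γ ∈ DecayC0 M γ lam) :
    M = Set.univ ∧
      (∃ c : ℝ, 0 < c ∧ ∀ z, γ z = (c : ℂ) • (1 : Matrix (Fin m) (Fin m) ℂ)) ∧
      ∀ z ∈ M, tensionId γ z = 0 := by
  have hm1 : 1 ≤ m := by omega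
  obtain ⟨I, F, h⟩ := exists_isRadialMetric hm1 hMopen hMconn hγ hconf hrot
  have h0 := h.zero_mem hm hcomplete hcurv
  have hp := h.logSlope_nonneg hm1 h0 hcurv
  obtain ⟨K, hK⟩ := h.exists_bound hm hlam hdecay hp
  have hI := h.Ici_subset_of_bound hm1 hcomplete h0 hK
  have hmem : ∀ z, z ∈ M := fun z => (h.mem_iff z).2 (hI (norm_nonneg z))
  have hconst : ∀ z, γ z = (F 0 : ℂ) • (1 : Matrix (Fin m) (Fin m) ℂ) := fun z => by
    rw [h.eq z (hmem z),
      h.eq_const hI hp (h.monotoneOn_logSlope hm1 hcurv) hK (norm_nonneg z)]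
  refine ⟨Set.eq_univ_of_forall hmem, ⟨F 0, h.pos 0 h0, hconst⟩, fun z hz => ?_⟩
  ext l
  rw [tensionId_conformal (f := fun _ => F 0) hMopen (fun y _ => ⟨h.pos 0 h0, hconst y⟩) hz l]
  simp [logGrad, partialDeriv]
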